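/- Let $\sigma$ be a connected skew diagram with $n\ge 1$ boxes (the set difference of two Young diagrams with the same corner, any two boxes being joined by a path of boxes sharing edges), and let $a\in\mathbb Z$. **Ladder representation.** Let $\mathbb H_n$ be the graded affine Hecke algebra of $gl(n)$ with parameter $1$: the complex algebra generated by $\mathbb C[S_n]$ (basis $t_w$) and $\mathbb A=\mathbb C[x_1,\dots,x_n]$ with $x_k t_{s}=t_{s}x_{s(k)}+\delta_{k,i}-\delta_{k,i+1}$ for $s=(i\ i{+}1)$. Give the leftmost box of the first row of $\sigma$ the content $a$, let contents increase by one to the right along rows and be constant on columns. If $\sigma$ has $r$ rows, and $a_i'$, $b_i'$ are the leftmost and rightmost contents in row $i$, put $\Delta_i=[a_i,b_i]$, $a_i=a_i'-(i-1)$, $b_i=b_i'-(i-1)$, $m_i=b_i-a_i+1$. Let $\langle\Delta_i\rangle$ be the one-dimensional $\mathbb H_{m_i}$-module that extends the sign representation of $S_{m_i}$ and on which $x_1,\dots,x_{m_i}$ act by $a_i,a_i+1,\dots,b_i$. The induced module $\mathbb H_n\otimes_{\mathbb H_{m_1}\times\cdots\times\mathbb H_{m_r}}(\langle\Delta_1\rangle\boxtimes\cdots\boxtimes\langle\Delta_r\rangle)$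 has a unique irreducible quotient, the integral ladder representation $\mathsf C(\sigma,a)$. Its $\mathbb A$-weights are the $\nu\in\mathbb C^n$ for which there is a nonzero $v\in \mathsf C(\sigma,a)$ with $x_iv=\nu_iv$ for all $i$. **Nilpotent pair.** Let $\mathfrak g=sl(n,\mathbb C)$. Let $\underline e=(e_1,e_2)\in\mathfrak g\times\mathfrak g$ be a pair in the orbit, under the adjoint group of $\mathfrak g$, of the distinguished nilpotent pair attached to $\sigma$: after labelling a basis of $\mathbb C^n$ by the boxes of $\sigma$, the first (second) element of that pair sends the basis vector of a box to that of the next box to the east (south), or to $0$ if there is none. Let $\underline h=(h_1,h_2)\in\mathfrak g\times\mathfrak g$ be an associated semisimple pair: $h_1,h_2$ are commuting semisimple elements, $\mathrm{ad}(h_1)$ and $\mathrm{ad}(h_2)$ have rational eigenvalues, $[h_i,e_j]=\delta_{ij}e_j$, and $\mathfrak z_{\mathfrak g}(\underline h)$ is a Cartan subalgebra. **Conclusion.** The variety $\mathcal B(\underline e,\underline h)$ of Borel subalgebras of $\mathfrak g$ containing $e_1,e_2,h_1,h_2$ is finite (zero-dimensional), and the $\mathbb A$-weights of $\mathsf C(\sigma,a)$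 are in one-to-one correspondence with the points of $\mathcal B(\underline e,\underline h)$. -/

import Mathlib

/-! ## The graded affine Hecke algebra of type `A` -/

/-- The defining relations of the graded affine Hecke algebra of `gl(n)` with parameter `k = 1`,
imposed on the free algebra on symbols `t_w` (`w ∈ S_n`) and `x_i` (`1 ≤ i ≤ n`).
Here `x_i` is the coordinate `ε_i ∈ V_ℂ = ℂⁿ`, the simple roots are `α = ε_i - ε_{i+1}`, and
`⟨ε_k, α^∨⟩ = δ_{k,i} - δ_{k,i+1}`. -/
inductive HeckeRel (n : ℕ) :
    FreeAlgebra ℂ (Equiv.Perm (Fin n) ⊕ Fin n) →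
    FreeAlgebra ℂ (Equiv.Perm (Fin n) ⊕ Fin n) → Prop
  /-- `t_1 = 1` -/
  | t_one : HeckeRel n (FreeAlgebra.ι ℂ (Sum.inl 1)) 1
  /-- `t_{uw} = t_u t_w` -/
  | t_mul (u w : Equiv.Perm (Fin n)) :
      HeckeRel n (FreeAlgebra.ι ℂ (Sum.inl (u * w)))
        (FreeAlgebra.ι ℂ (Sum.inl u) * FreeAlgebra.ι ℂ (Sum.inl w))
  /-- `x_i x_j = x_j x_i` -/
  | x_comm (i j : Fin n) :
      HeckeRel n (FreeAlgebra.ι ℂ (Sum.inr i) * FreeAlgebra.ι ℂ (Sum.inr j))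
        (FreeAlgebra.ι ℂ (Sum.inr j) * FreeAlgebra.ι ℂ (Sum.inr i))
  /-- `x_k t_s = t_s s(x_k) + ⟨x_k, α^∨⟩` for the simple reflection `s = s_α`, `α = ε_i - ε_j`,
  `j = i + 1` -/
  | cross (i j k : Fin n) (hij : (i : ℕ) + 1 = j) :
      HeckeRel n
        (FreeAlgebra.ι ℂ (Sum.inr k) * FreeAlgebra.ι ℂ (Sum.inl (Equiv.swap i j)))
        (FreeAlgebra.ι ℂ (Sum.inl (Equiv.swap i j)) *
            FreeAlgebra.ι ℂ (Sum.inr (Equiv.swap i j k)) +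
          ((if k = i then 1 else 0) - (if k = j then 1 else 0)))

/-- The graded affine Hecke algebra `ℍ_n` of `gl(n)`, with parameter `k = 1`. -/
def GradedHecke (n : ℕ) : Type := RingQuot (HeckeRel n)

namespace GradedHecke

noncomputable instance (n : ℕ) : Ring (GradedHecke n) :=
  inferInstanceAs (Ring (RingQuot (HeckeRel n)))

noncomputable instance (n : ℕ) : Algebra ℂ (GradedHecke n) :=
  inferInstanceAs (Algebra ℂ (RingQuot (HeckeRel n)))

/-- The element `t_w` of `ℍ_n`. -/
noncomputable def t {n : ℕ} (w : Equiv.Perm (Fin n)) : GradedHecke n :=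
  RingQuot.mkAlgHom ℂ (HeckeRel n) (FreeAlgebra.ι ℂ (Sum.inl w))

/-- The element `x_i = ε_i` of `ℍ_n`. -/
noncomputable def x {n : ℕ} (i : Fin n) : GradedHecke n :=
  RingQuot.mkAlgHom ℂ (HeckeRel n) (FreeAlgebra.ι ℂ (Sum.inr i))

/-- The set `Wt(X)` of weights of an `ℍ_n`-module `X` under the abelian subalgebra
`𝔸 = S(V_ℂ) = ℂ[x_1, …, x_n]`: the `ν ∈ V_ℂ^* ≅ ℂⁿ` that have a nonzero `v ∈ X` with
`x_i v = ν_i v` for all `i`. -/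
def weights {n : ℕ} (X : Type*) [AddCommGroup X] [Module (GradedHecke n) X] :
    Set (Fin n → ℂ) :=
  {ν | ∃ v : X, v ≠ 0 ∧ ∀ i, x i • v = algebraMap ℂ (GradedHecke n) (ν i) • v}

end GradedHecke

/-! ## Multisegments and Langlands quotients -/

/-- An (integral) multisegment: an ordered collection of segments `Δ_i = [lo i, hi i]`. -/
structure Multisegment where
  /-- the number of segments -/
  r : ℕ
  /-- the beginnings `a_i` -/
  lo : Fin r → ℤ
  /-- the ends `b_i` -/
  hi : Fin r → ℤ
  le : ∀ i, lo i ≤ hi i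

namespace Multisegment

/-- `m_i = |Δ_i| = b_i - a_i + 1` -/
def len (Δ : Multisegment) (i : Fin Δ.r) : ℕ := (Δ.hi i - Δ.lo i + 1).toNat

/-- `n = ∑ m_i` -/
def size (Δ : Multisegment) : ℕ := ∑ i, Δ.len i

/-- The position `p ∈ {1, …, n}`, written as `(i, k)`: it is the `k`-th position (counted from `0`)
in the `i`-th of the consecutive blocks of lengths `m_1, …, m_r`. -/
def pos (Δ : Multisegment) (p : Fin Δ.size) : (i : Fin Δ.r) × Fin (Δ.len i) :=
  finSigmaFinEquiv.symm p

/-- The sequence `λ = (a_1, …, b_1, a_2, …, b_2, …, a_r, …, b_r)`. -/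
def entry (Δ : Multisegment) (p : Fin Δ.size) : ℤ := Δ.lo (Δ.pos p).1 + ((Δ.pos p).2 : ℕ)

/-- The left ideal of `ℍ_n` generated by the elements `x_p - λ_p` and by `t_w - sgn(w)` for `w` in
the Young subgroup `S_{m_1} × ⋯ × S_{m_r}`. It is the left ideal generated by the annihilator, in
the parabolic subalgebra `ℍ_{m_1} × ⋯ × ℍ_{m_r}`, of the one-dimensional module
`⟨Δ_1⟩ ⊠ ⋯ ⊠ ⟨Δ_r⟩`, where `⟨Δ_i⟩` extends the sign representation and `𝔸` acts on it by
`(a_i, a_i + 1, …, b_i)`. -/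
noncomputable def leftIdeal (Δ : Multisegment) : Submodule (GradedHecke Δ.size) (GradedHecke Δ.size) :=
  Submodule.span (GradedHecke Δ.size)
    ({y | ∃ p, y = GradedHecke.x p - algebraMap ℂ (GradedHecke Δ.size) (Δ.entry p : ℂ)} ∪
      {y | ∃ w : Equiv.Perm (Fin Δ.size), (∀ p, (Δ.pos (w p)).1 = (Δ.pos p).1) ∧
        y = GradedHecke.t w - algebraMap ℂ (GradedHecke Δ.size) ((Equiv.Perm.sign w : ℤ) : ℂ)})

/-- The induced module `⟨Δ_1⟩ × ⋯ × ⟨Δ_r⟩ = ℍ_n ⊗_{ℍ_{m_1} × ⋯ × ℍ_{m_r}} (⟨Δ_1⟩ ⊠ ⋯ ⊠ ⟨Δ_r⟩)`.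
As the inducing module is one-dimensional, this is `ℍ_n` modulo the left ideal generated by its
annihilator. -/
abbrev Induced (Δ : Multisegment) : Type := GradedHecke Δ.size ⧸ Δ.leftIdeal

/-- `⟨Δ_1, …, Δ_r⟩`, the quotient of the induced module `⟨Δ_1⟩ × ⋯ × ⟨Δ_r⟩` by the intersection of
its maximal submodules. When the induced module has a unique irreducible quotient (equivalently,
when this module is simple), this is the unique irreducible quotient. -/
abbrev LanglandsQuotient (Δ : Multisegment) : Type :=
  Δ.Induced ⧸ Module.jacobson (GradedHecke Δ.size) Δ.Induced

end Multisegment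

/-! ## Skew diagrams -/

/-- A skew diagram: the set difference of two Young diagrams with the same corner.
Boxes are pairs (row, column), rows numbered downwards and columns to the right. -/
structure SkewDiagram where
  outer : YoungDiagram
  inner : YoungDiagram
  le : inner ≤ outer

namespace SkewDiagram

/-- The boxes of the skew diagram. -/
def cells (σ : SkewDiagram) : Finset (ℕ × ℕ) := σ.outer.cells \ σ.inner.cells

/-- The number `n` of boxes. -/
def size (σ : SkewDiagram) : ℕ := σ.cells.card

/-- `d` is the box immediately to the east of `c`. -/
def East (c d : ℕ × ℕ) : Prop := d = (c.1, c.2 + 1)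

/-- `d` is the box immediately to the south of `c`. -/
def South (c d : ℕ × ℕ) : Prop := d = (c.1 + 1, c.2)

/-- A skew diagram is connected if it has a box and any two boxes are joined by a path of boxes in
which consecutive boxes share an edge. -/
def Connected (σ : SkewDiagram) : Prop :=
  (SimpleGraph.fromRel fun c d : σ.cells => East c.1 d.1 ∨ South c.1 d.1).Connected

/-- The numbers of the (nonempty) rows. -/
def rows (σ : SkewDiagram) : Finset ℕ := σ.cells.image Prod.fst

/-- The columns that are met by the `i`-th nonempty row, counted from `0`. -/
def rowCols (σ : SkewDiagram) (i : Fin σ.rows.card) : Finset ℕ :=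
  (σ.cells.filter fun c => c.1 = σ.rows.orderEmbOfFin rfl i).image Prod.snd

theorem rowCols_nonempty (σ : SkewDiagram) (i : Fin σ.rows.card) : (σ.rowCols i).Nonempty := by
  obtain ⟨c, hc, h⟩ := Finset.mem_image.1 (Finset.orderEmbOfFin_mem σ.rows rfl i)
  exact ⟨c.2, Finset.mem_image.2 ⟨c, Finset.mem_filter.2 ⟨hc, h⟩, rfl⟩⟩

/-- The column of the leftmost box of the `i`-th row. -/
def left (σ : SkewDiagram) (i : Fin σ.rows.card) : ℕ := (σ.rowCols i).min' (σ.rowCols_nonempty i)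

/-- The column of the rightmost box of the `i`-th row. -/
def right (σ : SkewDiagram) (i : Fin σ.rows.card) : ℕ := (σ.rowCols i).max' (σ.rowCols_nonempty i)

/-- The content of the boxes in column `j`: the leftmost box of the first row has content `a`, and
contents increase by one to the right and are constant on the columns. (The argument `i`, any row,
only witnesses that there is a first row.) -/
def content (σ : SkewDiagram) (a : ℤ) (i : Fin σ.rows.card) (j : ℕ) : ℤ :=
  a + (j - σ.left ⟨0, i.pos⟩)

/-- The multisegment attached to `σ` and `a`: if `a_i'` and `b_i'` are the leftmost and the
rightmost content in row `i`, then `Δ_i = [a_i' - (i - 1), b_i' - (i - 1)]`. (Here rows are counted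
from `0`, so the shift is by `i`.) -/
def multisegment (σ : SkewDiagram) (a : ℤ) : Multisegment where
  r := σ.rows.card
  lo i := -(i : ℕ) + σ.content a i (σ.left i)
  hi i := -(i : ℕ) + σ.content a i (σ.right i)
  le i := by
    have h : σ.left i ≤ σ.right i := Finset.min'_le _ _ (Finset.max'_mem _ _)
    simp only [content]
    omega

/-- The integral ladder representation `C(σ, a) = ⟨Δ_1, …, Δ_r⟩`. -/
abbrev Ladder (σ : SkewDiagram) (a : ℤ) : Type := (σ.multisegment a).LanglandsQuotient

end SkewDiagram

/-! ## Nilpotent pairs and Borel subalgebras -/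

/-- The centralizer `𝔷_𝔤(h_1, h_2)`. -/
def pairCentralizer {L : Type*} [LieRing L] [LieAlgebra ℂ L] (h : L × L) : LieSubalgebra ℂ L where
  carrier := {y | ⁅y, h.1⁆ = 0 ∧ ⁅y, h.2⁆ = 0}
  add_mem' := by
    rintro y z ⟨h₁, h₂⟩ ⟨h₃, h₄⟩
    exact ⟨by rw [add_lie, h₁, h₃, add_zero], by rw [add_lie, h₂, h₄, add_zero]⟩
  zero_mem' := ⟨zero_lie _, zero_lie _⟩
  smul_mem' := by
    rintro c y ⟨h₁, h₂⟩
    exact ⟨by rw [smul_lie, h₁, smul_zero], by rw [smul_lie, h₂, smul_zero]⟩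
  lie_mem' := by
    rintro y z ⟨h₁, h₂⟩ ⟨h₃, h₄⟩
    exact ⟨by rw [lie_lie, h₁, h₃, lie_zero, lie_zero, sub_zero],
      by rw [lie_lie, h₂, h₄, lie_zero, lie_zero, sub_zero]⟩

/-- `h` is a semisimple pair associated with the pair `e`: `h_1, h_2` are commuting semisimple
elements, `ad h_1` and `ad h_2` have rational eigenvalues, `[h_i, e_j] = δ_{ij} e_j`, and
`𝔷_𝔤(h_1, h_2)` is a Cartan subalgebra. -/
structure IsAssociatedSemisimplePair {L : Type*} [LieRing L] [LieAlgebra ℂ L] (e h : L × L) :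
    Prop where
  semisimple₁ : (LieAlgebra.ad ℂ L h.1).IsSemisimple
  semisimple₂ : (LieAlgebra.ad ℂ L h.2).IsSemisimple
  rational₁ : ∀ c : ℂ, (LieAlgebra.ad ℂ L h.1).HasEigenvalue c → ∃ q : ℚ, c = q
  rational₂ : ∀ c : ℂ, (LieAlgebra.ad ℂ L h.2).HasEigenvalue c → ∃ q : ℚ, c = q
  comm : ⁅h.1, h.2⁆ = 0
  lie₁₁ : ⁅h.1, e.1⁆ = e.1
  lie₁₂ : ⁅h.1, e.2⁆ = 0
  lie₂₁ : ⁅h.2, e.1⁆ = 0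
  lie₂₂ : ⁅h.2, e.2⁆ = e.2
  cartan : (pairCentralizer h).IsCartanSubalgebra

/-- Borel subalgebras of a complex Lie algebra: the maximal solvable subalgebras. -/
def IsBorelSubalgebra {L : Type*} [LieRing L] [LieAlgebra ℂ L] (b : LieSubalgebra ℂ L) : Prop :=
  Maximal (fun b' : LieSubalgebra ℂ L => LieAlgebra.IsSolvable b') b

/-- The (points of the) variety `𝓑(e, h)` of Borel subalgebras containing `e_1, e_2, h_1, h_2`. -/
def borelVariety {L : Type*} [LieRing L] [LieAlgebra ℂ L] (e h : L × L) :
    Set (LieSubalgebra ℂ L) :=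
  {b | IsBorelSubalgebra b ∧ e.1 ∈ b ∧ e.2 ∈ b ∧ h.1 ∈ b ∧ h.2 ∈ b}

namespace SkewDiagram

/-- The Lie algebra `sl(n, ℂ)`, where `n` is the number of boxes of `σ`. -/
abbrev sl (σ : SkewDiagram) := LieAlgebra.SpecialLinear.sl (Fin σ.size) ℂ

open Classical in
/-- Given an enumeration `φ` of the boxes of `σ`, the endomorphism of `ℂⁿ` that sends the basis
vector of a box `c` to the basis vector of the box `d` with `R c d`, or to `0` if there is none. -/
noncomputable def moveMatrix (σ : SkewDiagram) (φ : σ.cells ≃ Fin σ.size)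
    (R : ℕ × ℕ → ℕ × ℕ → Prop) : Matrix (Fin σ.size) (Fin σ.size) ℂ :=
  Matrix.of fun p q => if R (φ.symm q).1 (φ.symm p).1 then 1 else 0

/-- `e` belongs to the adjoint orbit attached to the connected skew diagram `σ`: for an enumeration
of the boxes of `σ`, it is conjugate to the pair whose first member moves each box to the next box
to the east and whose second member moves each box to the next box to the south. (The adjoint group
of `sl(n, ℂ)` is `PGL(n, ℂ)`, acting by conjugation.) -/
def IsAttached (σ : SkewDiagram) (e : σ.sl × σ.sl) : Prop :=
  ∃ (φ : σ.cells ≃ Fin σ.size) (g : GL (Fin σ.size) ℂ),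
    e.1.1 = g.1 * σ.moveMatrix φ East * g⁻¹.1 ∧ e.2.1 = g.1 * σ.moveMatrix φ South * g⁻¹.1

end SkewDiagram

/-! Both sides of the correspondence are counted by the standard tableaux of the skew diagram.

Hecke side. Young's seminormal form makes the functions on standard tableaux into a module
(`TableauModule`) on which `x_k` multiplies by the shifted diagonal number of the box numbered `k`.
A standard tableau is determined by its sequence of diagonals (`IsStandard.eq_of_diag_eq`), so every
weight space is a line. Hence a nonzero submodule contains a basis vector, and admissible exchanges
carry it to all the others, so the module is simple. The basis vector of the row reading tableau has
weight `λ = (a_1, …, b_r)` and transforms by the sign under the Young subgroup, so the tableau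
module is a quotient of the induced module.

To see that it is the only simple quotient, one uses that the beginnings `a_i` decrease strictly.
Then `λ` is a shuffle of the segments in only one way (`eq_one_of_entry_eq`), and since the `x_k`
act triangularly on the vectors `t_w • gen`, the generalized weight space of `λ` in the induced
module is the line of the generator (`lineSubmodule_eq_top`). A submodule with nonzero image in the
tableau module then contains the generator, so the kernel is the largest proper submodule
(`nonempty_langlandsQuotient_equiv`).

Nilpotent side. The commutant of the pair has a character, the common diagonal entry of a matrix,
and an element on which it is nonzero is invertible (`isUnit_of_mem_pairCommutant`). Projections to
generalized eigenspaces of `h_1 + i h_2` assemble into such an element, and conjugation by it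
diagonalizes `h_1` and `h_2` without moving the nilpotent pair (`exists_normal_form`). The element
`h_1 + i h_2` then has distinct diagonal entries, so Lie's theorem shows that a Borel subalgebra
containing it is the stabilizer of a coordinate flag, that is, an ordering of the boxes. It contains
`e_1, e_2` exactly when the numbers grow to the east and to the south
(`nonempty_borelVariety_equiv`). -/

/-! ## Inversions of permutations and the Coxeter presentation of the symmetric group -/

namespace Equiv.Perm

variable {n : ℕ}

/-- The pairs `p < q` with `w q < w p`. -/
def inversionSet (w : Perm (Fin n)) : Finset (Fin n × Fin n) :=
  Finset.univ.filter fun p => p.1 < p.2 ∧ w p.2 < w p.1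

/-- The number of inversions of a permutation. -/
def invCount (w : Perm (Fin n)) : ℕ := w.inversionSet.card

theorem mem_inversionSet {w : Perm (Fin n)} {p : Fin n × Fin n} :
    p ∈ w.inversionSet ↔ p.1 < p.2 ∧ w p.2 < w p.1 := by
  simp [inversionSet]

/-- An adjacent transposition reverses the relative order of one pair only. -/
theorem swap_lt_swap {i j : Fin n} (hij : (i : ℕ) + 1 = j) {p q : Fin n} (h : p < q)
    (hne : ¬(p = i ∧ q = j)) : swap i j p < swap i j q := by
  rw [swap_apply_def, swap_apply_def]
  simp only [Fin.lt_def, Fin.ext_iff] at *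
  split_ifs <;> omega

/-- Applying the transposition to both coordinates matches the inversions of the product with those
of `w` other than `(i, j)`. -/
theorem invCount_mul_swap {i j : Fin n} (hij : (i : ℕ) + 1 = j) {w : Perm (Fin n)}
    (h : w j < w i) : (w * swap i j).invCount + 1 = w.invCount := by
  have hlt : i < j := by rw [Fin.lt_def]; omega
  have hmem : (i, j) ∈ w.inversionSet := mem_inversionSet.2 ⟨hlt, h⟩
  rw [invCount, invCount, ← Finset.card_erase_add_one hmem]
  congr 1
  refine Finset.card_nbij' (fun p => (swap i j p.1, swap i j p.2))
    (fun p => (swap i j p.1, swap i j p.2)) ?_ ?_ ?_ ?_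
  · rintro ⟨p, q⟩ hp
    obtain ⟨h1, h2⟩ := mem_inversionSet.1 hp
    simp only [coe_mul, Function.comp_apply] at h1 h2
    refine Finset.mem_erase.2 ⟨?_, mem_inversionSet.2 ⟨swap_lt_swap hij h1 ?_, h2⟩⟩
    · intro he
      simp only [Prod.mk.injEq] at he
      have e1 : p = j := by rw [← swap_apply_self i j p, he.1, swap_apply_left]
      have e2 : q = i := by rw [← swap_apply_self i j q, he.2, swap_apply_right]
      subst e1 e2
      exact absurd h1 hlt.not_gt
    · rintro ⟨rfl, rfl⟩
      rw [swap_apply_left, swap_apply_right] at h2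
      exact absurd h2 h.not_gt
  · rintro ⟨p, q⟩ hp
    obtain ⟨h0, hp⟩ := Finset.mem_erase.1 hp
    obtain ⟨h1, h2⟩ := mem_inversionSet.1 hp
    refine mem_inversionSet.2 ⟨swap_lt_swap hij h1 ?_, ?_⟩
    · rintro ⟨rfl, rfl⟩
      exact h0 rfl
    · simpa using h2
  · rintro ⟨p, q⟩ _
    simp
  · rintro ⟨p, q⟩ _
    simp

theorem invCount_mul_swap_of_lt {i j : Fin n} (hij : (i : ℕ) + 1 = j) {w : Perm (Fin n)}
    (h : w i < w j) : (w * swap i j).invCount = w.invCount + 1 := by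
  have := invCount_mul_swap hij (w := w * swap i j) (by simpa using h)
  rw [mul_assoc, swap_mul_self, mul_one] at this
  exact this.symm

theorem invCount_inv (w : Perm (Fin n)) : w⁻¹.invCount = w.invCount := by
  refine Finset.card_nbij' (fun p => (w⁻¹ p.2, w⁻¹ p.1)) (fun p => (w p.2, w p.1)) ?_ ?_ ?_ ?_
  · rintro ⟨p, q⟩ hp
    have := mem_inversionSet.1 hp
    exact mem_inversionSet.2 ⟨this.2, by simpa using this.1⟩
  · rintro ⟨p, q⟩ hp
    have := mem_inversionSet.1 hp
    exact mem_inversionSet.2 ⟨this.2, by simpa using this.1⟩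
  · rintro ⟨p, q⟩ _
    simp
  · rintro ⟨p, q⟩ _
    simp

theorem invCount_swap_mul {i j : Fin n} (hij : (i : ℕ) + 1 = j) {w : Perm (Fin n)}
    (h : w⁻¹ j < w⁻¹ i) : (swap i j * w).invCount + 1 = w.invCount := by
  rw [← invCount_inv w, ← invCount_mul_swap hij h, ← invCount_inv, mul_inv_rev, swap_inv]

theorem invCount_swap_mul_of_lt {i j : Fin n} (hij : (i : ℕ) + 1 = j) {w : Perm (Fin n)}
    (h : w⁻¹ i < w⁻¹ j) : (swap i j * w).invCount = w.invCount + 1 := by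
  rw [← invCount_inv w, ← invCount_mul_swap_of_lt hij h, ← invCount_inv, mul_inv_rev, swap_inv]

theorem invCount_swap_mul_le {i j : Fin n} (hij : (i : ℕ) + 1 = j) (w : Perm (Fin n)) :
    (swap i j * w).invCount ≤ w.invCount + 1 := by
  have hne : w⁻¹ i ≠ w⁻¹ j := fun e => by
    have := w⁻¹.injective e
    subst this
    omega
  rcases lt_or_gt_of_ne hne with h | h
  · exact (invCount_swap_mul_of_lt hij h).le
  · have := invCount_swap_mul hij h
    omega

/-- A strictly increasing self-map of a finite chain lies above the identity. Applied to `w` and to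
its inverse, this leaves only the identity. -/
theorem eq_one_of_forall_lt (w : Perm (Fin n))
    (h : ∀ i j : Fin n, (i : ℕ) + 1 = j → w i < w j) : w = 1 := by
  have hm : StrictMono w := by
    intro p q hpq
    have key : ∀ d : ℕ, ∀ p q : Fin n, (p : ℕ) + d + 1 = q → w p < w q := by
      intro d
      induction d with
      | zero => exact fun p q hh => h p q (by simpa using hh)
      | succ d ih =>
        intro p q hh
        have hlt : (p : ℕ) + d + 1 < n := by omega
        exact (ih p ⟨p + d + 1, hlt⟩ rfl).trans (h _ _ (by simp; omega))
    exact key ((q : ℕ) - p - 1) p q (by rw [Fin.lt_def] at hpq; omega)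
  have hid : w = (1 : Perm (Fin n)) := by
    ext p
    have hge : ∀ p : Fin n, p ≤ w p := fun p => hm.le_apply
    have hm' : StrictMono (w⁻¹ : Perm (Fin n)) := by
      intro p q hpq
      rw [← hm.lt_iff_lt]
      simpa using hpq
    have h2 : p ≤ w⁻¹ p := hm'.le_apply
    have h3 := hm.monotone h2
    rw [show w (w⁻¹ p) = p by simp] at h3
    rw [le_antisymm h3 (hge p), coe_one, id]
  exact hid

/-- A permutation other than the identity has a descent. -/
theorem exists_descent {w : Perm (Fin n)} (hw : w ≠ 1) :
    ∃ i j : Fin n, (i : ℕ) + 1 = j ∧ w j < w i := by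
  by_contra! hcon
  refine hw (eq_one_of_forall_lt w fun i j hij => lt_of_le_of_ne (hcon i j hij) fun e => ?_)
  have := w.injective e
  subst this
  omega

/-- Induction on permutations along descents. -/
theorem descent_induction {motive : Perm (Fin n) → Prop} (one : motive 1)
    (step : ∀ (w : Perm (Fin n)) (i j : Fin n), (i : ℕ) + 1 = j → w j < w i →
      motive (w * swap i j) → motive w) (w : Perm (Fin n)) : motive w := by
  induction hm : w.invCount using Nat.strong_induction_on generalizing w with
  | _ m ih =>
    by_cases hw : w = 1
    · exact hw ▸ one
    · obtain ⟨i, j, hij, h⟩ := exists_descent hw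
      have := invCount_mul_swap hij h
      exact step w i j hij h (ih _ (by omega) _ rfl)

/-! ### Words for permutations and the Coxeter presentation -/

section Presentation

variable {M : Type*} [Monoid M]

open Classical in
/-- The product of the `S i` along a word for `w`, found by removing descents. -/
noncomputable def descentProd (S : ℕ → M) (w : Perm (Fin n)) : M :=
  if hw : w = 1 then 1
  else
    descentProd S
      (w * swap (exists_descent hw).choose (exists_descent hw).choose_spec.choose) *
      S (exists_descent hw).choose
termination_by w.invCount
decreasing_by
  have h := (exists_descent hw).choose_spec.choose_spec
  have := invCount_mul_swap h.1 h.2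
  omega

theorem descentProd_one (S : ℕ → M) : descentProd S (1 : Perm (Fin n)) = 1 := by
  rw [descentProd, dif_pos rfl]

theorem exists_descentProd_eq (S : ℕ → M) {w : Perm (Fin n)} (hw : w ≠ 1) :
    ∃ i j : Fin n, (i : ℕ) + 1 = j ∧ w j < w i ∧
      descentProd S w = descentProd S (w * swap i j) * S i := by
  refine ⟨_, _, (exists_descent hw).choose_spec.choose_spec.1,
    (exists_descent hw).choose_spec.choose_spec.2, ?_⟩
  rw [descentProd, dif_neg hw]

variable {S : ℕ → M}

theorem swap_braid {i j k : Fin n} (hij : (i : ℕ) + 1 = j) (hjk : (j : ℕ) + 1 = k) :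
    swap i j * swap j k * swap i j = swap j k * swap i j * swap j k := by
  have h1 : i ≠ j := by rintro rfl; omega
  have h2 : j ≠ k := by rintro rfl; omega
  have h3 : i ≠ k := by rintro rfl; omega
  ext p
  simp only [coe_mul, Function.comp_apply, swap_apply_def]
  split_ifs <;> simp_all

theorem swap_comm_of_lt {i j k l : Fin n} (hij : (i : ℕ) + 1 = j) (hkl : (k : ℕ) + 1 = l)
    (h : (i : ℕ) + 1 < k) : swap i j * swap k l = swap k l * swap i j := by
  have h1 : i ≠ k := by rintro rfl; omega
  have h2 : i ≠ l := by rintro rfl; omega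
  have h3 : j ≠ k := by rintro rfl; omega
  have h4 : j ≠ l := by rintro rfl; omega
  exact (Disjoint.commute (by
    intro p
    simp only [swap_apply_def]
    split_ifs <;> simp_all))

/-- The value of `descentProd` may be computed from any descent. -/
theorem descentProd_eq
    (braid : ∀ i, i + 2 < n → S i * S (i + 1) * S i = S (i + 1) * S i * S (i + 1))
    (comm : ∀ i j, i + 1 < j → j + 1 < n → S i * S j = S j * S i)
    (w : Perm (Fin n)) {i j : Fin n} (hij : (i : ℕ) + 1 = j) (h : w j < w i) :
    descentProd S w = descentProd S (w * swap i j) * S i := by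
  induction hm : w.invCount using Nat.strong_induction_on generalizing w i j with
  | _ m ih =>
    have hw : w ≠ 1 := by
      rintro rfl
      simp only [coe_one, id, Fin.lt_def] at h
      omega
    -- Two distant descents: by induction both sides can be computed through `w * swap i j * swap k
    -- l`, where commutation joins them.
    have far : ∀ i j k l : Fin n, (i : ℕ) + 1 = j → (k : ℕ) + 1 = l → (i : ℕ) + 1 < k →
        w j < w i → w l < w k →
        descentProd S (w * swap i j) * S i = descentProd S (w * swap k l) * S k := by
      intro i j k l hij hkl hik h1 h2
      have n1 : k ≠ i := by rintro rfl; omega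
      have n2 : k ≠ j := by rintro rfl; omega
      have n3 : l ≠ i := by rintro rfl; omega
      have n4 : l ≠ j := by rintro rfl; omega
      have c1 := invCount_mul_swap hij h1
      have c2 := invCount_mul_swap hkl h2
      rw [ih _ (by omega) (w * swap i j) hkl
          (by simpa [swap_apply_of_ne_of_ne, n1, n2, n3, n4] using h2) rfl,
        ih _ (by omega) (w * swap k l) hij
          (by simpa [swap_apply_of_ne_of_ne, n1.symm, n2.symm, n3.symm, n4.symm] using h1) rfl,
        mul_assoc w, mul_assoc w, swap_comm_of_lt hij hkl hik, mul_assoc, mul_assoc,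
        comm i k hik (by omega)]
    -- Two neighbouring descents make `w` decreasing on three consecutive places. Three descents can
    -- then be removed in either order, and the braid relation compares the two words.
    have near : ∀ i j k : Fin n, (i : ℕ) + 1 = j → (j : ℕ) + 1 = k →
        w j < w i → w k < w j →
        descentProd S (w * swap i j) * S i = descentProd S (w * swap j k) * S j := by
      intro i j k hij hjk h1 h2
      have n1 : i ≠ j := by rintro rfl; omega
      have n2 : j ≠ k := by rintro rfl; omega
      have n3 : i ≠ k := by rintro rfl; omega
      have c1 := invCount_mul_swap hij h1
      have c2 := invCount_mul_swap hjk h2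
      have d1 : (w * swap i j) k < (w * swap i j) j := by
        simpa [swap_apply_of_ne_of_ne, n3.symm, n2.symm] using h2.trans h1
      have d2 : (w * swap j k) j < (w * swap j k) i := by
        simpa [swap_apply_of_ne_of_ne, n1, n3] using h2.trans h1
      have c3 := invCount_mul_swap hjk d1
      have c4 := invCount_mul_swap hij d2
      rw [ih _ (by omega) _ hjk d1 rfl, ih _ (by omega) _ hij d2 rfl,
        ih _ (by omega) (w * swap i j * swap j k) hij
          (by simpa [swap_apply_of_ne_of_ne, n1, n3, n3.symm, n2.symm] using h2) rfl,
        ih _ (by omega) (w * swap j k * swap i j) hjk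
          (by simpa [swap_apply_of_ne_of_ne, n1, n3, n3.symm, n2.symm] using h1) rfl]
      have e : w * swap i j * swap j k * swap i j = w * swap j k * swap i j * swap j k := by
        have := swap_braid hij hjk
        simp only [mul_assoc] at this ⊢
        rw [this]
      have b := braid i (by omega)
      rw [e, ← hij, mul_assoc, mul_assoc, mul_assoc, mul_assoc, ← mul_assoc (S i), b]
      simp only [mul_assoc]
    obtain ⟨k, l, hkl, h', he⟩ := exists_descentProd_eq S hw
    rw [he]
    rcases lt_trichotomy (i : ℕ) k with hik | hik | hik
    · rcases (show (i : ℕ) + 1 = k ∨ (i : ℕ) + 1 < k by omega) with hk | hk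
      · have : j = k := Fin.ext (by omega)
        subst this
        exact (near i j l hij hkl h h').symm
      · exact (far i j k l hij hkl hk h h').symm
    · have e1 : i = k := Fin.ext hik
      have e2 : j = l := Fin.ext (by omega)
      subst e1 e2
      rfl
    · rcases (show (k : ℕ) + 1 = i ∨ (k : ℕ) + 1 < i by omega) with hk | hk
      · have : l = i := Fin.ext (by omega)
        subst this
        exact near k l j hkl hij h' h
      · exact far k l i j hkl hij hk h' h

/-- The Coxeter presentation of the symmetric group: elements that satisfy the braid relations and
are involutions are the images of the adjacent transpositions under a homomorphism. -/
theorem exists_hom_of_braid (sq : ∀ i, i + 1 < n → S i * S i = 1)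
    (braid : ∀ i, i + 2 < n → S i * S (i + 1) * S i = S (i + 1) * S i * S (i + 1))
    (comm : ∀ i j, i + 1 < j → j + 1 < n → S i * S j = S j * S i) :
    ∃ ρ : Perm (Fin n) →* M, ∀ i j : Fin n, (i : ℕ) + 1 = j → ρ (swap i j) = S i := by
  -- Multiplication by a generator on either side of a descent: where the number of inversions
  -- falls, the relation `S i * S i = 1` is needed.
  have step : ∀ (w : Perm (Fin n)) (i j : Fin n), (i : ℕ) + 1 = j →
      descentProd S (w * swap i j) = descentProd S w * S i := by
    intro w i j hij
    have hne : w i ≠ w j := fun e => by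
      have := w.injective e
      subst this
      omega
    rcases lt_or_gt_of_ne hne with h | h
    · have := descentProd_eq braid comm (w * swap i j) hij (by simpa using h)
      rwa [mul_assoc w, swap_mul_self, mul_one] at this
    · rw [descentProd_eq braid comm w hij h, mul_assoc, sq i (by omega), mul_one]
  refine ⟨⟨⟨descentProd S, descentProd_one S⟩, fun u w => ?_⟩, fun i j hij => ?_⟩
  · change descentProd S (u * w) = descentProd S u * descentProd S w
    induction w using descent_induction with
    | one => rw [descentProd_one, mul_one, mul_one]
    | step w i j hij h ih =>
      have e := step (w * swap i j) i j hij
      rw [mul_assoc w, swap_mul_self, mul_one] at e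
      rw [e, ← mul_assoc, ← ih, ← step _ i j hij, ← mul_assoc, mul_assoc, swap_mul_self, mul_one]
  · change descentProd S (swap i j) = S i
    rw [← one_mul (swap i j), step 1 i j hij, descentProd_one, one_mul]

end Presentation

end Equiv.Perm

/-! ## Positions in a multisegment -/

theorem finSigmaFinEquiv_lt_of_fst_lt {m : ℕ} {n : Fin m → ℕ} {a b : (i : Fin m) × Fin (n i)}
    (h : a.1 < b.1) : finSigmaFinEquiv a < finSigmaFinEquiv b := by
  rw [Fin.lt_def, finSigmaFinEquiv_apply, finSigmaFinEquiv_apply]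
  -- Sums over different types `Fin i` become sums over ranges, so that the offsets of two blocks
  -- can be compared.
  have key : ∀ i : Fin m, ∑ j : Fin i, n (Fin.castLE i.2.le j) =
      ∑ j ∈ Finset.range i, if hj : j < m then n ⟨j, hj⟩ else 0 := by
    intro i
    rw [Finset.sum_range]
    refine Finset.sum_congr rfl fun j _ => ?_
    rw [dif_pos (j.2.trans i.2)]
    rfl
  rw [key, key]
  have h1 : ∑ j ∈ Finset.range (a.1 + 1), (if hj : j < m then n ⟨j, hj⟩ else 0) ≤
      ∑ j ∈ Finset.range b.1, if hj : j < m then n ⟨j, hj⟩ else 0 :=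
    Finset.sum_le_sum_of_subset (Finset.range_subset_range.2 h)
  rw [Finset.sum_range_succ, dif_pos a.1.2, Fin.eta] at h1
  have := a.2.2
  omega

theorem finSigmaFinEquiv_lt_of_snd_lt {m : ℕ} {n : Fin m → ℕ} {i : Fin m} {k l : Fin (n i)}
    (h : k < l) : finSigmaFinEquiv ⟨i, k⟩ < finSigmaFinEquiv ⟨i, l⟩ := by
  rw [Fin.lt_def, finSigmaFinEquiv_apply, finSigmaFinEquiv_apply]
  exact Nat.add_lt_add_left h _

namespace Multisegment

variable (Δ : Multisegment)

/-- The number of the block that contains a position. -/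
def block (p : Fin Δ.size) : Fin Δ.r := (Δ.pos p).1

theorem finSigmaFinEquiv_pos (p : Fin Δ.size) : finSigmaFinEquiv (Δ.pos p) = p :=
  finSigmaFinEquiv.apply_symm_apply p

theorem block_mono : Monotone Δ.block := by
  intro p q h
  by_contra! hc
  have := finSigmaFinEquiv_lt_of_fst_lt hc
  rw [finSigmaFinEquiv_pos, finSigmaFinEquiv_pos] at this
  exact absurd h this.not_ge

theorem entry_lt {p q : Fin Δ.size} (h : p < q) (hb : Δ.block p = Δ.block q) :
    Δ.entry p < Δ.entry q := by
  unfold entry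
  unfold block at hb
  have hp := Δ.finSigmaFinEquiv_pos p
  have hq := Δ.finSigmaFinEquiv_pos q
  generalize Δ.pos p = a at *
  generalize Δ.pos q = b at *
  obtain ⟨i, k⟩ := a
  obtain ⟨j, l⟩ := b
  dsimp only at hb
  subst hb
  have : k < l := by
    by_contra! hc
    rcases hc.lt_or_eq with hc | rfl
    · have := finSigmaFinEquiv_lt_of_snd_lt hc
      rw [hp, hq] at this
      exact absurd h this.not_gt
    · exact absurd h (by rw [← hp, ← hq]; exact lt_irrefl _)
  rw [Fin.lt_def] at this
  simpa using this

theorem lo_le_entry (p : Fin Δ.size) : Δ.lo (Δ.block p) ≤ Δ.entry p := by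
  unfold entry block
  omega

theorem exists_first (i : Fin Δ.r) :
    ∃ p, Δ.block p = i ∧ Δ.entry p = Δ.lo i ∧ ∀ q, Δ.block q = i → p ≤ q := by
  have hlen : 0 < Δ.len i := by
    have := Δ.le i
    unfold len
    omega
  obtain ⟨p, hp⟩ : ∃ p, Δ.pos p = ⟨i, ⟨0, hlen⟩⟩ := finSigmaFinEquiv.symm.surjective _
  have h1 : Δ.block p = i := by simp only [block, hp]
  have h2 : Δ.entry p = Δ.lo i := by
    unfold entry
    rw [hp]
    simp
  refine ⟨p, h1, h2, fun q hq => ?_⟩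
  by_contra! hc
  have h3 := Δ.entry_lt hc (hq.trans h1.symm)
  have h4 := Δ.lo_le_entry q
  rw [hq] at h4
  omega

/-- If the beginnings of the segments decrease strictly, then the sequence of entries is a shuffle
of the segments in only one way. -/
theorem eq_one_of_entry_eq (hlo : StrictAnti Δ.lo) {w : Equiv.Perm (Fin Δ.size)}
    (hinc : ∀ p q, p < q → Δ.block p = Δ.block q → w p < w q)
    (hw : ∀ p, Δ.entry (w p) = Δ.entry p) : w = 1 := by
  suffices h : ∀ p, w p = p from Equiv.ext h
  intro p
  induction p using WellFoundedLT.induction with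
  | _ p ih =>
    set q := w⁻¹ p with hq
    have hwq : w q = p := by simp [hq]
    rcases lt_trichotomy q p with h | h | h
    · exact absurd ((ih q h).symm.trans hwq) h.ne
    · rw [← h]
      rwa [h] at hwq ⊢
    · exfalso
      have he : Δ.entry p = Δ.entry q := by rw [← hw q, hwq]
      rcases (Δ.block_mono h.le).eq_or_lt with hb | hb
      · exact (Δ.entry_lt h hb).ne he
      -- Here `q` is in a later block than `p`. As `lo` decreases strictly, `q` cannot begin its
      -- block. The beginning `q₀` is then sent below `p`, where `w` is already the identity, so
      -- `q₀` precedes `p`, against the order of the blocks.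
      · obtain ⟨q₀, hq₀, hlo₀, hmin⟩ := Δ.exists_first (Δ.block q)
        have hle := hmin q rfl
        have h1 : q₀ < q := by
          refine lt_of_le_of_ne hle fun e => ?_
          have h2 := hlo hb
          have h3 := Δ.lo_le_entry p
          rw [he, ← e, hlo₀] at h3
          omega
        have h4 := hinc q₀ q h1 hq₀
        rw [hwq] at h4
        have h5 : q₀ = w q₀ := (w.injective (ih _ h4)).symm
        rw [← h5] at h4
        have := Δ.block_mono h4.le
        rw [hq₀] at this
        exact absurd hb this.not_gt

end Multisegment

/-! ## Skew diagrams and their standard tableaux -/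

namespace SkewDiagram

variable {σ : SkewDiagram}

/-- Skew diagrams are order convex, because both Young diagrams are closed under moves up and left.
-/
theorem mem_cells_of_le {c d m : ℕ × ℕ} (hc : c ∈ σ.cells) (hd : d ∈ σ.cells) (h1 : c.1 ≤ m.1)
    (h2 : c.2 ≤ m.2) (h3 : m.1 ≤ d.1) (h4 : m.2 ≤ d.2) : m ∈ σ.cells := by
  simp only [cells, Finset.mem_sdiff, YoungDiagram.mem_cells] at *
  exact ⟨σ.outer.up_left_mem h3 h4 hd.1, fun hm => hc.2 (σ.inner.up_left_mem h1 h2 hm)⟩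

/-- `d` is the next box to the east or to the south of `c`. -/
def Arrow (c d : ℕ × ℕ) : Prop := East c d ∨ South c d

/-- The difference `column - row`, which numbers the diagonals. -/
def diag (c : ℕ × ℕ) : ℤ := (c.2 : ℤ) - c.1

theorem Arrow.diag_eq {c d : ℕ × ℕ} (h : Arrow c d) : diag d = diag c + 1 ∨ diag d = diag c - 1 := by
  rcases h with rfl | rfl <;> simp only [diag] <;> push_cast <;> omega

theorem connected_induction (hσ : σ.Connected) {P : σ.cells → Prop}
    (h : ∀ c d : σ.cells, Arrow c.1 d.1 → (P c ↔ P d)) {c : σ.cells} (hc : P c) (d : σ.cells) :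
    P d := by
  obtain ⟨w⟩ := hσ.preconnected c d
  induction w with
  | nil => exact hc
  | cons hadj _ ih =>
    refine ih ?_
    rcases hadj.2 with h' | h'
    · exact (h _ _ h').1 hc
    · exact (h _ _ h').2 hc

/-! ### Standard tableaux and admissible exchanges -/

section Standard

variable {N : ℕ}

/-- A tableau `T`, in which the box `T i` has the number `i`, is standard if the numbers increase
along rows and columns. -/
def IsStandard (T : Fin N ≃ σ.cells) : Prop :=
  ∀ c d : σ.cells, Arrow c.1 d.1 → T.symm c < T.symm d

/-- The tableau with two numbers exchanged. -/
abbrev exchange (i j : Fin N) (T : Fin N ≃ σ.cells) : Fin N ≃ σ.cells := (Equiv.swap i j).trans T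

theorem exchange_exchange (i j : Fin N) (T : Fin N ≃ σ.cells) :
    exchange i j (exchange i j T) = T := by
  ext1 p
  simp

namespace IsStandard

variable {T T' : Fin N ≃ σ.cells}

/-- By convexity, a path of southward and then eastward steps from `c` to `d` stays inside the
diagram. -/
theorem symm_mono (hT : IsStandard T) {c d : σ.cells} (h1 : c.1.1 ≤ d.1.1) (h2 : c.1.2 ≤ d.1.2) :
    T.symm c ≤ T.symm d := by
  induction hm : (d.1.1 - c.1.1) + (d.1.2 - c.1.2) generalizing c with
  | zero =>
    have : c = d := Subtype.ext (Prod.ext (by omega) (by omega))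
    rw [this]
  | succ m ih =>
    rcases h1.lt_or_eq with h | h
    · have hmem : (c.1.1 + 1, c.1.2) ∈ σ.cells :=
        mem_cells_of_le c.2 d.2 (by simp) le_rfl (by simp; omega) h2
      exact (hT c ⟨_, hmem⟩ (Or.inr rfl)).le.trans
        (ih (c := ⟨_, hmem⟩) (by simp; omega) h2 (by simp; omega))
    · have hmem : (c.1.1, c.1.2 + 1) ∈ σ.cells :=
        mem_cells_of_le c.2 d.2 le_rfl (by simp) h1 (by simp; omega)
      exact (hT c ⟨_, hmem⟩ (Or.inl rfl)).le.trans
        (ih (c := ⟨_, hmem⟩) h1 (by simp; omega) (by simp; omega))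

/-- The south, east and southeast neighbours of `c` are all in the diagram, and their three distinct
numbers lie after that of `c` and not after that of `d`. -/
theorem add_three_le (hT : IsStandard T) {c d : σ.cells} (h : diag c.1 = diag d.1)
    (hlt : c.1.1 < d.1.1) : (T.symm c : ℕ) + 3 ≤ T.symm d := by
  unfold diag at h
  have m1 : (c.1.1 + 1, c.1.2) ∈ σ.cells :=
    mem_cells_of_le c.2 d.2 (by simp) le_rfl (by simp; omega) (by simp; omega)
  have m2 : (c.1.1, c.1.2 + 1) ∈ σ.cells :=
    mem_cells_of_le c.2 d.2 le_rfl (by simp) (by simp; omega) (by simp; omega)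
  have m3 : (c.1.1 + 1, c.1.2 + 1) ∈ σ.cells :=
    mem_cells_of_le c.2 d.2 (by simp) (by simp) (by simp; omega) (by simp; omega)
  have h1 := hT c ⟨_, m1⟩ (Or.inr rfl)
  have h2 := hT c ⟨_, m2⟩ (Or.inl rfl)
  have h3 := hT ⟨_, m1⟩ ⟨_, m3⟩ (Or.inl rfl)
  have h4 := hT ⟨_, m2⟩ ⟨_, m3⟩ (Or.inr rfl)
  have h5 : T.symm ⟨_, m3⟩ ≤ T.symm d := hT.symm_mono (by simp; omega) (by simp; omega)
  have h6 : (T.symm ⟨_, m1⟩ : ℕ) ≠ T.symm ⟨_, m2⟩ := fun e => by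
    have := T.symm.injective (Fin.ext e)
    simp at this
  simp only [Fin.lt_def, Fin.le_def] at *
  omega

/-- This keeps the denominators of the seminormal form nonzero for numbers at distance one or two,
the only distances in the relations. -/
theorem eq_of_diag_eq_of_close (hT : IsStandard T) {i j : Fin N} (h : diag (T i).1 = diag (T j).1)
    (h1 : (i : ℕ) < j + 3) (h2 : (j : ℕ) < i + 3) : i = j := by
  rcases lt_trichotomy (T i).1.1 (T j).1.1 with hlt | heq | hlt
  · have := hT.add_three_le h hlt
    simp at this
    omega
  · refine T.injective (Subtype.ext (Prod.ext heq ?_))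
    unfold diag at h
    omega
  · have := hT.add_three_le h.symm hlt
    simp at this
    omega

/-- Exchanging consecutive numbers alters the order of those two boxes only, so no other arrow can
be violated. -/
theorem arrow_of_not_exchange (hT : IsStandard T) {i j : Fin N} (hij : (i : ℕ) + 1 = j)
    (h : ¬IsStandard (exchange i j T)) : Arrow (T i).1 (T j).1 := by
  unfold IsStandard at h
  push Not at h
  obtain ⟨c, d, hcd, hle⟩ := h
  by_cases he : T.symm c = i ∧ T.symm d = j
  · rwa [← he.1, ← he.2, Equiv.apply_symm_apply, Equiv.apply_symm_apply]
  · have := Equiv.Perm.swap_lt_swap hij (hT c d hcd) he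
    simp only [exchange, Equiv.symm_trans_apply, Equiv.symm_swap] at hle
    exact absurd this hle.not_gt

/-- Both tableaux being standard, the two boxes are incomparable, and incomparable boxes lie at
least two diagonals apart. -/
theorem diag_ne (hT : IsStandard T) {i j : Fin N} (hij : (i : ℕ) + 1 = j)
    (hT' : IsStandard (exchange i j T)) :
    diag (T i).1 ≠ diag (T j).1 + 1 ∧ diag (T i).1 ≠ diag (T j).1 - 1 := by
  have hlt : i < j := by rw [Fin.lt_def]; omega
  have key : ¬((T i).1.1 ≤ (T j).1.1 ∧ (T i).1.2 ≤ (T j).1.2) ∧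
      ¬((T j).1.1 ≤ (T i).1.1 ∧ (T j).1.2 ≤ (T i).1.2) := by
    constructor
    · rintro ⟨h1, h2⟩
      have := hT'.symm_mono h1 h2
      simp [exchange] at this
      exact absurd hlt this.not_gt
    · rintro ⟨h1, h2⟩
      have := hT.symm_mono h1 h2
      simp at this
      exact absurd hlt this.not_gt
  unfold diag
  omega

/-- At the first disagreement one of the two boxes lies higher on their common diagonal. The other
tableau has given that box a smaller number, where the two agree, which contradicts injectivity. -/
theorem eq_of_diag_eq (hT : IsStandard T) (hT' : IsStandard T')
    (h : ∀ i, diag (T i).1 = diag (T' i).1) : T = T' := by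
  have key : ∀ {T T' : Fin N ≃ σ.cells}, IsStandard T' → (∀ i, diag (T i).1 = diag (T' i).1) →
      ∀ i, (∀ j < i, T j = T' j) → ¬(T i).1.1 < (T' i).1.1 := by
    intro T T' hT' h i ih hlt
    have hd := h i
    have h1 := hT'.add_three_le hd hlt
    have h2 : T'.symm (T i) < i := by
      rw [Fin.lt_def]
      simp at h1
      omega
    have h3 := ih _ h2
    rw [Equiv.apply_symm_apply] at h3
    exact h2.ne (T.injective h3)
  suffices hh : ∀ i, T i = T' i from Equiv.ext hh
  intro i
  induction i using WellFoundedLT.induction with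
  | _ i ih =>
    have h1 := key hT' h i ih
    have h2 := key hT (fun i => (h i).symm) i fun j hj => (ih j hj).symm
    have hd := h i
    unfold diag at hd
    exact Subtype.ext (Prod.ext (by omega) (by omega))

/-- Any two standard tableaux are joined by admissible exchanges of consecutive numbers. -/
theorem exchange_induction {motive : (Fin N ≃ σ.cells) → Prop} (hT' : IsStandard T')
    (base : motive T')
    (step : ∀ (T : Fin N ≃ σ.cells) (i j : Fin N), (i : ℕ) + 1 = j → IsStandard T →
      IsStandard (exchange i j T) → motive (exchange i j T) → motive T)
    (hT : IsStandard T) : motive T := by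
  induction hm : Equiv.Perm.invCount (T.trans T'.symm) using Nat.strong_induction_on
    generalizing T with
  | _ m ih =>
    by_cases hw : T.trans T'.symm = (1 : Equiv.Perm (Fin N))
    · have : T = T' := by
        ext1 p
        have := congrArg (fun e : Equiv.Perm (Fin N) => T' (e p)) hw
        simpa using this
      rwa [this]
    · obtain ⟨i, j, hij, hlt⟩ := Equiv.Perm.exists_descent hw
      -- The boxes of a descent are in the opposite order in `T'`, so no arrow joins them, and
      -- exchanging them removes one inversion relative to `T'`.
      have hex : IsStandard (exchange i j T) := by
        by_contra hc
        have := hT' _ _ (hT.arrow_of_not_exchange hij hc)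
        exact absurd hlt this.not_gt
      have : Equiv.Perm.invCount ((exchange i j T).trans T'.symm) + 1 = _ :=
        Equiv.Perm.invCount_mul_swap hij hlt
      exact step T i j hij hT hex (ih _ (by omega) hex rfl)

end IsStandard

end Standard

/-! ### The row reading tableau -/

theorem nonempty_rows (hσ : σ.Connected) : 0 < σ.rows.card := by
  obtain ⟨c⟩ := hσ.nonempty
  exact Finset.card_pos.2 ⟨c.1.1, Finset.mem_image_of_mem _ c.2⟩

theorem mem_rows {m : ℕ} : m ∈ σ.rows ↔ ∃ q, (m, q) ∈ σ.cells := by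
  simp [rows]

/-- If a row were missing, lying above it would be a property preserved along every edge, against
connectedness. -/
theorem mem_rows_of_le (hσ : σ.Connected) {r m s : ℕ} (hr : r ∈ σ.rows) (hs : s ∈ σ.rows)
    (h1 : r ≤ m) (h2 : m ≤ s) : m ∈ σ.rows := by
  by_contra hm
  obtain ⟨p, hp⟩ := mem_rows.1 hr
  obtain ⟨q, hq⟩ := mem_rows.1 hs
  have hne : ∀ c : σ.cells, c.1.1 ≠ m := fun c hc => hm (hc ▸ mem_rows.2 ⟨_, c.2⟩)
  have := connected_induction hσ (P := fun c => c.1.1 < m) (c := ⟨_, hp⟩) (fun c d h => by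
    have h1 := hne c
    have h2 := hne d
    rcases h with h | h
    · rw [h]
    · rw [h] at h2 ⊢
      dsimp only at h2 ⊢
      omega)
    (lt_of_le_of_ne h1 (hne ⟨_, hp⟩)) ⟨_, hq⟩
  exact absurd h2 (not_le.2 this)

/-- The number of the `i`-th nonempty row. -/
def row (σ : SkewDiagram) (i : Fin σ.rows.card) : ℕ := σ.rows.orderEmbOfFin rfl i

theorem row_mem (i : Fin σ.rows.card) : σ.row i ∈ σ.rows := Finset.orderEmbOfFin_mem _ _ _

theorem row_strictMono : StrictMono σ.row := (σ.rows.orderEmbOfFin rfl).strictMono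

theorem exists_row {m : ℕ} (hm : m ∈ σ.rows) : ∃ i, σ.row i = m := by
  have : m ∈ Set.range (σ.rows.orderEmbOfFin rfl) := by
    rw [Finset.range_orderEmbOfFin]
    exact hm
  exact this

/-- The nonempty rows are consecutive. So the shift by `i` in the segments is a shift by the true
row number, up to a constant. -/
theorem row_eq (hσ : σ.Connected) (i : Fin σ.rows.card) :
    σ.row i = σ.row ⟨0, i.pos⟩ + i := by
  obtain ⟨i, hi⟩ := i
  induction i with
  | zero => simp
  | succ i ih =>
    have ih := ih (by omega)
    have h1 : σ.row ⟨i, by omega⟩ < σ.row ⟨i + 1, hi⟩ := row_strictMono (by simp)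
    obtain ⟨k, hk⟩ := exists_row (mem_rows_of_le hσ (row_mem ⟨i, by omega⟩) (row_mem ⟨i + 1, hi⟩)
      (Nat.le_succ _) h1)
    have h2 : (⟨i, by omega⟩ : Fin σ.rows.card) < k := by
      rw [← row_strictMono.lt_iff_lt, hk]
      omega
    have h3 : (⟨i + 1, hi⟩ : Fin σ.rows.card) ≤ k := by
      rw [Fin.lt_def] at h2
      rw [Fin.le_def]
      exact h2
    have h4 := row_strictMono.monotone h3
    dsimp only at ih ⊢
    omega

theorem mem_rowCols {i : Fin σ.rows.card} {q : ℕ} :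
    q ∈ σ.rowCols i ↔ (σ.row i, q) ∈ σ.cells := by
  simp [rowCols, row]

theorem left_mem (i : Fin σ.rows.card) : (σ.row i, σ.left i) ∈ σ.cells :=
  mem_rowCols.1 (Finset.min'_mem _ _)

theorem right_mem (i : Fin σ.rows.card) : (σ.row i, σ.right i) ∈ σ.cells :=
  mem_rowCols.1 (Finset.max'_mem _ _)

theorem left_le {i : Fin σ.rows.card} {q : ℕ} (h : (σ.row i, q) ∈ σ.cells) : σ.left i ≤ q :=
  Finset.min'_le _ _ (mem_rowCols.2 h)

theorem le_right {i : Fin σ.rows.card} {q : ℕ} (h : (σ.row i, q) ∈ σ.cells) : q ≤ σ.right i :=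
  Finset.le_max' _ _ (mem_rowCols.2 h)

/-- Were a lower row to start further right, convexity would add a box to the left of its first one.
-/
theorem left_antitone : Antitone σ.left := by
  intro i j hij
  by_contra! hc
  have hr := row_strictMono.monotone hij
  have := mem_cells_of_le (m := (σ.row j, σ.left i)) (left_mem i) (left_mem j) hr le_rfl le_rfl
    hc.le
  exact absurd (left_le this) (not_le.2 hc)

variable (σ) in
-- The weak decrease of the left ends becomes strict through the shift by `i`. The uniqueness of the
-- irreducible quotient rests on this.
theorem multisegment_lo_strictAnti (a : ℤ) : StrictAnti (σ.multisegment a).lo := by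
  intro i j hij
  have h1 := left_antitone (σ := σ) hij.le
  have h2 : (i : ℕ) < j := hij
  change -(j : ℤ) + (a + ((σ.left j : ℤ) - _)) < -(i : ℤ) + (a + ((σ.left i : ℤ) - _))
  omega

theorem multisegment_len (a : ℤ) (i : Fin σ.rows.card) :
    (σ.multisegment a).len i + σ.left i = σ.right i + 1 := by
  have h := left_le (right_mem (σ := σ) i)
  change ((-(i : ℤ) + (a + ((σ.right i : ℤ) - _))) - (-(i : ℤ) + (a + ((σ.left i : ℤ) - _))) +
    1).toNat + _ = _
  omega

/-- The `k`-th box of the `i`-th row. -/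
noncomputable def rowBox (σ : SkewDiagram) (a : ℤ)
    (p : (i : Fin (σ.multisegment a).r) × Fin ((σ.multisegment a).len i)) : σ.cells :=
  ⟨(σ.row p.1, σ.left p.1 + p.2), by
    have h1 := p.2.2
    have h2 := multisegment_len (σ := σ) a p.1
    exact mem_cells_of_le (left_mem p.1) (right_mem p.1) le_rfl (by simp) le_rfl
      (by dsimp only; omega)⟩

theorem rowBox_bijective (a : ℤ) : Function.Bijective (σ.rowBox a) := by
  constructor
  · rintro ⟨i, k⟩ ⟨j, l⟩ h
    have h1 : σ.row i = σ.row j := congrArg (fun c : σ.cells => c.1.1) h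
    have h2 : σ.left i + k = σ.left j + l := congrArg (fun c : σ.cells => c.1.2) h
    obtain rfl := row_strictMono.injective h1
    obtain rfl : k = l := Fin.ext (by omega)
    rfl
  · rintro ⟨⟨r, q⟩, hc⟩
    obtain ⟨i, rfl⟩ := exists_row (mem_rows.2 ⟨q, hc⟩)
    have h1 := left_le hc
    have h2 := le_right hc
    have h3 := multisegment_len (σ := σ) a i
    exact ⟨⟨i, ⟨q - σ.left i, by omega⟩⟩, Subtype.ext (Prod.ext rfl (by simp [rowBox]; omega))⟩

/-- The row reading tableau: the boxes are numbered row by row. -/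
noncomputable def rowTableau (σ : SkewDiagram) (a : ℤ) :
    Fin (σ.multisegment a).size ≃ σ.cells :=
  finSigmaFinEquiv.symm.trans (Equiv.ofBijective _ (rowBox_bijective a))

theorem rowTableau_apply (a : ℤ) (p : Fin (σ.multisegment a).size) :
    σ.rowTableau a p = σ.rowBox a ((σ.multisegment a).pos p) := rfl

theorem rowTableau_fst (a : ℤ) (p : Fin (σ.multisegment a).size) :
    (σ.rowTableau a p).1.1 = σ.row ((σ.multisegment a).block p) := rfl

theorem multisegment_size (a : ℤ) : (σ.multisegment a).size = σ.size := by
  have := Fintype.card_congr (σ.rowTableau a)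
  rwa [Fintype.card_fin, Fintype.card_coe] at this

/-- The constant by which the contents differ from `column - row`. -/
def contentShift (σ : SkewDiagram) (hσ : σ.Connected) (a : ℤ) : ℤ :=
  a - diag (σ.row ⟨0, nonempty_rows hσ⟩, σ.left ⟨0, nonempty_rows hσ⟩)

theorem entry_eq (hσ : σ.Connected) (a : ℤ) (p : Fin (σ.multisegment a).size) :
    (σ.multisegment a).entry p = σ.contentShift hσ a + diag (σ.rowTableau a p).1 := by
  rw [rowTableau_apply]
  unfold Multisegment.entry
  generalize (σ.multisegment a).pos p = b
  obtain ⟨i, k⟩ := b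
  have h := row_eq hσ i
  change -(i : ℤ) + (a + ((σ.left i : ℤ) - σ.left ⟨0, _⟩)) + ((k : ℕ) : ℤ) =
    a - ((σ.left ⟨0, _⟩ : ℤ) - σ.row ⟨0, _⟩) + (((σ.left i + k : ℕ) : ℤ) - (σ.row i : ℤ))
  rw [h]
  push_cast
  ring

theorem rowTableau_isStandard (a : ℤ) : IsStandard (σ.rowTableau a) := by
  intro c d hcd
  obtain ⟨⟨i, k⟩, rfl⟩ := (rowBox_bijective a).2 c
  obtain ⟨⟨j, l⟩, rfl⟩ := (rowBox_bijective a).2 d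
  have hsymm : ∀ p, (σ.rowTableau a).symm (σ.rowBox a p) = finSigmaFinEquiv p := fun p => by
    refine (Equiv.symm_apply_eq (σ.rowTableau a)).2 (congrArg (σ.rowBox a) ?_)
    exact (finSigmaFinEquiv.symm_apply_apply p).symm
  rw [hsymm, hsymm]
  rcases hcd with h | h
  · have h1 : σ.row j = σ.row i := congrArg Prod.fst h
    have h2 : σ.left j + l = σ.left i + k + 1 := congrArg Prod.snd h
    obtain rfl := row_strictMono.injective h1
    exact finSigmaFinEquiv_lt_of_snd_lt (by rw [Fin.lt_def]; omega)
  · have h1 : σ.row j = σ.row i + 1 := congrArg Prod.fst h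
    exact finSigmaFinEquiv_lt_of_fst_lt (row_strictMono.lt_iff_lt.1 (by dsimp only; omega))

/-- Consecutive positions of one block are neighbours in a row. -/
theorem rowTableau_east (a : ℤ) {p q : Fin (σ.multisegment a).size} (hpq : (p : ℕ) + 1 = q)
    (hb : (σ.multisegment a).block p = (σ.multisegment a).block q) :
    East (σ.rowTableau a p).1 (σ.rowTableau a q).1 := by
  have h1 : (σ.rowTableau a p).1.1 = (σ.rowTableau a q).1.1 := by
    rw [rowTableau_fst, rowTableau_fst, hb]
  have hT := rowTableau_isStandard (σ := σ) a
  have hlt : p < q := by rw [Fin.lt_def]; omega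
  have h2 : (σ.rowTableau a p).1.2 < (σ.rowTableau a q).1.2 := by
    by_contra! hc
    have := hT.symm_mono h1.ge hc
    simp at this
    exact absurd hlt this.not_gt
  have hm : ((σ.rowTableau a p).1.1, (σ.rowTableau a p).1.2 + 1) ∈ σ.cells :=
    mem_cells_of_le (σ.rowTableau a p).2 (σ.rowTableau a q).2 le_rfl (by simp) h1.le h2
  have h3 := hT (σ.rowTableau a p) ⟨_, hm⟩ (Or.inl rfl)
  have h4 : (σ.rowTableau a).symm ⟨_, hm⟩ ≤ (σ.rowTableau a).symm (σ.rowTableau a q) :=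
    hT.symm_mono h1.le h2
  simp only [Equiv.symm_apply_apply] at h3 h4
  -- The number of the east neighbour exceeds `p` and is at most `q = p + 1`.
  have h5 : (σ.rowTableau a).symm ⟨_, hm⟩ = q := by
    rw [Fin.lt_def] at h3
    rw [Fin.le_def] at h4
    exact Fin.ext (by omega)
  rw [← h5, Equiv.apply_symm_apply]
  rfl

end SkewDiagram

/-! ## The seminormal representation on standard tableaux -/

namespace SkewDiagram

/-- The reading order on boxes. -/
def ReadBefore (c d : ℕ × ℕ) : Prop := c.1 < d.1 ∨ (c.1 = d.1 ∧ c.2 < d.2)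

theorem Arrow.readBefore {c d : ℕ × ℕ} (h : Arrow c d) : ReadBefore c d := by
  rcases h with rfl | rfl
  · exact Or.inr ⟨rfl, Nat.lt_succ_self _⟩
  · exact Or.inl (Nat.lt_succ_self _)

/-- The diagonal coefficient of the seminormal form. -/
noncomputable def diagCoef (c d : ℕ × ℕ) : ℂ := ((diag c : ℂ) - diag d)⁻¹

open Classical in
/-- The off-diagonal coefficient of the seminormal form. -/
noncomputable def exchangeCoef (c d : ℕ × ℕ) : ℂ :=
  if ReadBefore d c then 1 - diagCoef c d ^ 2 else 1

theorem diagCoef_symm (c d : ℕ × ℕ) : diagCoef d c = -diagCoef c d := by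
  rw [diagCoef, diagCoef, ← inv_neg, neg_sub]

/-- Only this product matters for the relations. The reading order decides which factor carries it,
which avoids square roots. On a common diagonal `diagCoef` is zero by the convention for inverses,
and both sides are one. -/
theorem exchangeCoef_mul {c d : ℕ × ℕ} (h : c ≠ d) :
    exchangeCoef c d * exchangeCoef d c = 1 - diagCoef c d ^ 2 := by
  have hne : ¬(c.1 = d.1 ∧ c.2 = d.2) := fun e => h (Prod.ext e.1 e.2)
  by_cases h1 : ReadBefore c d
  · have h2 : ¬ReadBefore d c := by
      unfold ReadBefore at *
      omega
    rw [exchangeCoef, exchangeCoef, if_neg h2, if_pos h1, diagCoef_symm c d]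
    ring
  · have h2 : ReadBefore d c := by
      unfold ReadBefore at *
      omega
    rw [exchangeCoef, exchangeCoef, if_pos h2, if_neg h1]
    ring

theorem diagCoef_sq_of_arrow {c d : ℕ × ℕ} (h : Arrow c d) : diagCoef c d ^ 2 = 1 := by
  rw [diagCoef]
  rcases h.diag_eq with e | e <;> rw [e] <;> push_cast <;> norm_num

theorem exchangeCoef_of_arrow {c d : ℕ × ℕ} (h : Arrow d c) : exchangeCoef c d = 0 := by
  rw [exchangeCoef, if_pos h.readBefore, diagCoef_symm, neg_sq, diagCoef_sq_of_arrow h, sub_self]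

theorem diagCoef_of_east {c d : ℕ × ℕ} (h : East c d) : diagCoef c d = -1 := by
  rw [diagCoef, h]
  simp only [diag]
  push_cast
  norm_num

/-- With `u`, `v` the two successive differences, this is the partial fraction identity `1/(uv) =
(1/(u+v))(1/u + 1/v)`, the core of the braid relation. -/
theorem diagCoef_mul {b c d : ℕ × ℕ} (h1 : diag b ≠ diag c) (h2 : diag c ≠ diag d)
    (h3 : diag b ≠ diag d) :
    diagCoef b c * diagCoef c d = diagCoef b d * (diagCoef b c + diagCoef c d) := by
  have e1 : (diag b : ℂ) - diag c ≠ 0 := sub_ne_zero.2 (by exact_mod_cast h1)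
  have e2 : (diag c : ℂ) - diag d ≠ 0 := sub_ne_zero.2 (by exact_mod_cast h2)
  have e3 : (diag b : ℂ) - diag d ≠ 0 := sub_ne_zero.2 (by exact_mod_cast h3)
  unfold diagCoef
  field_simp
  ring

variable {σ : SkewDiagram} {N : ℕ}

/-- The operator of an adjacent transposition on the functions on all tableaux. -/
noncomputable def seminormal (i j : Fin N) :
    Module.End ℂ ((Fin N ≃ σ.cells) → ℂ) where
  toFun f T := diagCoef (T i).1 (T j).1 * f T +
    exchangeCoef (T i).1 (T j).1 * f (exchange i j T)
  map_add' f g := by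
    ext T
    simp only [Pi.add_apply]
    ring
  map_smul' c f := by
    ext T
    simp only [Pi.smul_apply, smul_eq_mul, RingHom.id_apply]
    ring

theorem seminormal_apply (i j : Fin N) (f : (Fin N ≃ σ.cells) → ℂ) (T : Fin N ≃ σ.cells) :
    seminormal i j f T = diagCoef (T i).1 (T j).1 * f T +
      exchangeCoef (T i).1 (T j).1 * f (exchange i j T) := rfl

variable (σ N) in
/-- The functions that vanish on the tableaux that are not standard. -/
def tableauSpace : Submodule ℂ ((Fin N ≃ σ.cells) → ℂ) where
  carrier := {f | ∀ T, ¬IsStandard T → f T = 0}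
  add_mem' := fun {f g} hf hg T hT => by rw [Pi.add_apply, hf T hT, hg T hT, add_zero]
  zero_mem' := fun _ _ => rfl
  smul_mem' := fun c f hf T hT => by rw [Pi.smul_apply, hf T hT, smul_zero]

/-- A nonstandard `T` can receive a contribution only from a standard exchange. Then an arrow leads
from the box `T j` to the box `T i`, and the coefficient vanishes. -/
theorem seminormal_mem {i j : Fin N} (hij : (i : ℕ) + 1 = j) {f : (Fin N ≃ σ.cells) → ℂ}
    (hf : f ∈ tableauSpace σ N) : seminormal i j f ∈ tableauSpace σ N := by
  intro T hT
  rw [seminormal_apply, hf T hT, mul_zero, zero_add]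
  by_cases h : IsStandard (exchange i j T)
  · have := h.arrow_of_not_exchange hij (by rwa [exchange_exchange])
    simp only [exchange, Equiv.trans_apply, Equiv.swap_apply_left, Equiv.swap_apply_right] at this
    rw [exchangeCoef_of_arrow this, zero_mul]
  · rw [hf _ h, mul_zero]

/-- The diagonal coefficient changes sign under the exchange, so the mixed terms cancel, and
`exchangeCoef_mul` supplies the rest. -/
theorem seminormal_seminormal {i j : Fin N} (hij : (i : ℕ) + 1 = j) (f : (Fin N ≃ σ.cells) → ℂ) :
    seminormal i j (seminormal i j f) = f := by
  ext T
  have hne : (T i).1 ≠ (T j).1 := fun e => by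
    have := T.injective (Subtype.ext e)
    subst this
    omega
  have h := exchangeCoef_mul hne
  simp only [seminormal_apply, exchange_exchange]
  simp only [exchange, Equiv.trans_apply, Equiv.swap_apply_left, Equiv.swap_apply_right]
  rw [diagCoef_symm (T i).1 (T j).1]
  linear_combination f T * h

theorem seminormal_comm {i j k l : Fin N} (hij : (i : ℕ) + 1 = j) (hkl : (k : ℕ) + 1 = l)
    (hik : (i : ℕ) + 1 < k) (f : (Fin N ≃ σ.cells) → ℂ) :
    seminormal i j (seminormal k l f) = seminormal k l (seminormal i j f) := by
  have n1 : i ≠ k := by rintro rfl; omega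
  have n2 : i ≠ l := by rintro rfl; omega
  have n3 : j ≠ k := by rintro rfl; omega
  have n4 : j ≠ l := by rintro rfl; omega
  ext T
  have he : exchange k l (exchange i j T) = exchange i j (exchange k l T) := by
    ext1 p
    have := congrArg (fun w : Equiv.Perm (Fin N) => T (w p))
      (Equiv.Perm.swap_comm_of_lt hij hkl hik)
    simpa using this
  simp only [seminormal_apply, he]
  simp only [exchange, Equiv.trans_apply, Equiv.swap_apply_of_ne_of_ne n1 n2,
    Equiv.swap_apply_of_ne_of_ne n3 n4, Equiv.swap_apply_of_ne_of_ne n1.symm n3.symm,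
    Equiv.swap_apply_of_ne_of_ne n2.symm n4.symm]
  ring

theorem seminormal_braid {i j k : Fin N} (hij : (i : ℕ) + 1 = j) (hjk : (j : ℕ) + 1 = k)
    {f : (Fin N ≃ σ.cells) → ℂ} (hf : f ∈ tableauSpace σ N) :
    seminormal i j (seminormal j k (seminormal i j f)) =
      seminormal j k (seminormal i j (seminormal j k f)) := by
  ext T
  by_cases hT : IsStandard T
  · have n1 : i ≠ j := by rintro rfl; omega
    have n2 : j ≠ k := by rintro rfl; omega
    have n3 : i ≠ k := by rintro rfl; omega
    have d1 : diag (T i).1 ≠ diag (T j).1 := fun e =>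
      n1 (hT.eq_of_diag_eq_of_close e (by omega) (by omega))
    have d2 : diag (T j).1 ≠ diag (T k).1 := fun e =>
      n2 (hT.eq_of_diag_eq_of_close e (by omega) (by omega))
    have d3 : diag (T i).1 ≠ diag (T k).1 := fun e =>
      n3 (hT.eq_of_diag_eq_of_close e (by omega) (by omega))
    have he : exchange i j (exchange j k (exchange i j T)) =
        exchange j k (exchange i j (exchange j k T)) := by
      ext1 p
      have := congrArg (fun w : Equiv.Perm (Fin N) => T (w p)) (Equiv.Perm.swap_braid hij hjk)
      simpa using this
    simp only [seminormal_apply, he, exchange_exchange]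
    simp only [exchange, Equiv.trans_apply, Equiv.swap_apply_left, Equiv.swap_apply_right,
      Equiv.swap_apply_of_ne_of_ne n1 n3, Equiv.swap_apply_of_ne_of_ne n3.symm n2.symm]
    have ne1 : (T i).1 ≠ (T j).1 := fun e => d1 (by rw [e])
    have ne2 : (T j).1 ≠ (T k).1 := fun e => d2 (by rw [e])
    have b1 := exchangeCoef_mul ne1
    have b2 := exchangeCoef_mul ne2
    have a1 := diagCoef_mul d1 d2 d3
    rw [diagCoef_symm (T i).1 (T j).1, diagCoef_symm (T j).1 (T k).1]
    generalize (Equiv.swap i j).trans T = T1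
    generalize (Equiv.swap j k).trans T = T2
    generalize (Equiv.swap i j).trans ((Equiv.swap j k).trans T) = T3
    generalize (Equiv.swap j k).trans ((Equiv.swap i j).trans T) = T4
    generalize diagCoef (T i).1 (T j).1 = x at *
    generalize diagCoef (T j).1 (T k).1 = y at *
    generalize diagCoef (T i).1 (T k).1 = z at *
    generalize exchangeCoef (T i).1 (T j).1 = p at *
    generalize exchangeCoef (T j).1 (T i).1 = p' at *
    generalize exchangeCoef (T j).1 (T k).1 = q at *
    generalize exchangeCoef (T k).1 (T j).1 = q' at *
    -- Once `b1` and `b2` replace the products `p * p'` and `q * q'`, the coefficients of `f T`, `f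
    -- T1` and `f T2` differ by multiples of `a1`; the other terms agree.
    linear_combination (f T * (x - y) + f T1 * p - f T2 * q) * a1 + f T * z * (b1 - b2)
  · rw [seminormal_mem hij (seminormal_mem hjk (seminormal_mem hij hf)) T hT,
      seminormal_mem hjk (seminormal_mem hij (seminormal_mem hjk hf)) T hT]

variable (σ N) in
/-- The module with a basis indexed by the standard tableaux, on which `x_k` acts by the contents
(shifted by `κ`) and the adjacent transpositions act by the seminormal form. -/
def TableauModule (_κ : ℤ) : Type := tableauSpace σ N

namespace TableauModule

variable {κ : ℤ}

noncomputable instance : AddCommGroup (TableauModule σ N κ) :=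
  inferInstanceAs (AddCommGroup (tableauSpace σ N))

noncomputable instance : Module ℂ (TableauModule σ N κ) :=
  inferInstanceAs (Module ℂ (tableauSpace σ N))

/-- The function on tableaux that underlies an element. -/
def coeff (f : TableauModule σ N κ) : (Fin N ≃ σ.cells) → ℂ := Subtype.val f

theorem coeff_mem (f : TableauModule σ N κ) : coeff f ∈ tableauSpace σ N := Subtype.property f

@[ext] theorem ext {f g : TableauModule σ N κ} (h : ∀ T, coeff f T = coeff g T) : f = g :=
  Subtype.ext (funext h)

theorem coeff_add (f g : TableauModule σ N κ) (T) : coeff (f + g) T = coeff f T + coeff g T := rfl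

theorem coeff_smul (c : ℂ) (f : TableauModule σ N κ) (T) : coeff (c • f) T = c * coeff f T := rfl

theorem coeff_zero (T) : coeff (0 : TableauModule σ N κ) T = 0 := rfl

/-- The operator of an adjacent transposition on the tableau module. -/
noncomputable def swapOp (i j : Fin N) (hij : (i : ℕ) + 1 = j) :
    Module.End ℂ (TableauModule σ N κ) where
  toFun f := ⟨seminormal i j (coeff f), seminormal_mem hij (coeff_mem f)⟩
  map_add' f g := Subtype.ext (map_add (seminormal i j) (coeff f) (coeff g))
  map_smul' c f := Subtype.ext (map_smul (seminormal i j) c (coeff f))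

open Classical in
/-- The operator of the `m`-th adjacent transposition. -/
noncomputable def adjOp (m : ℕ) : Module.End ℂ (TableauModule σ N κ) :=
  if h : m + 1 < N then swapOp ⟨m, by omega⟩ ⟨m + 1, h⟩ rfl else 1

theorem coeff_adjOp (m : ℕ) (h : m + 1 < N) (f : TableauModule σ N κ) :
    coeff (adjOp m f) = seminormal ⟨m, by omega⟩ ⟨m + 1, h⟩ (coeff f) := by
  rw [adjOp, dif_pos h]
  rfl

theorem exists_rep : ∃ ρ : Equiv.Perm (Fin N) →* Module.End ℂ (TableauModule σ N κ),
    ∀ i j : Fin N, (i : ℕ) + 1 = j → ρ (Equiv.swap i j) = adjOp i := by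
  refine Equiv.Perm.exists_hom_of_braid (fun m h => ?_) (fun m h => ?_) (fun m m' h h' => ?_)
  · ext f T
    simp only [Module.End.mul_apply]
    rw [coeff_adjOp m h, coeff_adjOp m h, seminormal_seminormal rfl]
    rfl
  · ext f T
    have e := coeff_adjOp (σ := σ) (κ := κ) m (show m + 1 < N by omega)
    have e' := coeff_adjOp (σ := σ) (κ := κ) (m + 1) h
    simp only [Module.End.mul_apply]
    rw [e, e', e, e', e, e', seminormal_braid rfl rfl (coeff_mem f)]
  · ext f T
    have e := coeff_adjOp (σ := σ) (κ := κ) m (show m + 1 < N by omega)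
    have e' := coeff_adjOp (σ := σ) (κ := κ) m' h'
    simp only [Module.End.mul_apply]
    rw [e, e', e', e, seminormal_comm rfl rfl h]

/-- The representation of the symmetric group by the seminormal form. -/
noncomputable def rep : Equiv.Perm (Fin N) →* Module.End ℂ (TableauModule σ N κ) :=
  exists_rep.choose

theorem coeff_rep_swap {i j : Fin N} (hij : (i : ℕ) + 1 = j) (f : TableauModule σ N κ) :
    coeff (rep (Equiv.swap i j) f) = seminormal i j (coeff f) := by
  rw [rep, exists_rep.choose_spec i j hij, coeff_adjOp i (by omega)]
  congr 2
  exact Fin.ext hij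

/-- Multiplication by the content of the box with the number `k`. -/
noncomputable def contentOp (k : Fin N) : Module.End ℂ (TableauModule σ N κ) where
  toFun f := ⟨fun T => ((κ + diag (T k).1 : ℤ) : ℂ) * coeff f T, fun T hT => by
    dsimp only
    rw [coeff_mem f T hT, mul_zero]⟩
  map_add' f g := ext fun T => mul_add _ _ _
  map_smul' c f := ext fun T => mul_left_comm _ _ _

theorem coeff_contentOp (k : Fin N) (f : TableauModule σ N κ) (T) :
    coeff (contentOp k f) T = ((κ + diag (T k).1 : ℤ) : ℂ) * coeff f T := rfl

/-- The exchange term intertwines the contents exactly. The diagonal term leaves `diagCoef` times a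
difference of contents, which is `1`, `-1` or `0`: the constant in the cross relation. -/
theorem contentOp_rep_swap {i j : Fin N} (hij : (i : ℕ) + 1 = j) (k : Fin N) :
    (contentOp k * rep (Equiv.swap i j) : Module.End ℂ (TableauModule σ N κ)) =
      rep (Equiv.swap i j) * contentOp (Equiv.swap i j k) +
        ((if k = i then 1 else 0) - (if k = j then 1 else 0)) := by
  have hne : i ≠ j := by rintro rfl; omega
  ext f T
  have e : coeff ((((if k = i then 1 else 0) - (if k = j then 1 else 0) :
      Module.End ℂ (TableauModule σ N κ))) f) T =
      ((if k = i then 1 else 0) - (if k = j then 1 else 0)) * coeff f T := by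
    split_ifs with h1 h2 h2
    · exact absurd (h1.symm.trans h2) hne
    · simp
    · simp only [zero_sub, neg_mul, one_mul]
      rfl
    · simp [coeff_zero]
  rw [LinearMap.add_apply, coeff_add, e]
  simp only [Module.End.mul_apply, coeff_contentOp, coeff_rep_swap hij, seminormal_apply]
  have e2 : (exchange i j T) (Equiv.swap i j k) = T k := by simp
  rw [e2]
  by_cases hT : IsStandard T
  · have hd : diag (T i).1 ≠ diag (T j).1 := fun h =>
      hne (hT.eq_of_diag_eq_of_close h (by omega) (by omega))
    have hd' : (diag (T i).1 : ℂ) - diag (T j).1 ≠ 0 := sub_ne_zero.2 (by exact_mod_cast hd)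
    have key : diagCoef (T i).1 (T j).1 * ((diag (T i).1 : ℂ) - diag (T j).1) = 1 :=
      inv_mul_cancel₀ hd'
    push_cast
    by_cases h1 : k = i
    · subst h1
      rw [if_pos rfl, if_neg hne, Equiv.swap_apply_left]
      linear_combination coeff f T * key
    · by_cases h2 : k = j
      · subst h2
        rw [if_neg h1, if_pos rfl, Equiv.swap_apply_right]
        linear_combination -(coeff f T * key)
      · rw [if_neg h1, if_neg h2, Equiv.swap_apply_of_ne_of_ne h1 h2]
        ring
  · rw [coeff_mem f T hT]
    ring

/-- The action of the graded Hecke algebra. -/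
noncomputable def action (σ : SkewDiagram) (N : ℕ) (κ : ℤ) :
    GradedHecke N →ₐ[ℂ] Module.End ℂ (TableauModule σ N κ) :=
  RingQuot.liftAlgHom ℂ ⟨FreeAlgebra.lift ℂ (Sum.elim (fun w => rep w) contentOp), by
    intro a b h
    induction h with
    | t_one => simp
    | t_mul u w => simp
    | x_comm i j =>
      simp only [map_mul, FreeAlgebra.lift_ι_apply, Sum.elim_inr]
      ext f T
      simp only [Module.End.mul_apply, coeff_contentOp]
      ring
    | cross i j k hij =>
      have e : ∀ p : Prop, [Decidable p] → (FreeAlgebra.lift ℂ (Sum.elim (fun w => rep w) contentOp))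
          (if p then 1 else 0 : FreeAlgebra ℂ (Equiv.Perm (Fin N) ⊕ Fin N)) =
          (if p then 1 else 0 : Module.End ℂ (TableauModule σ N κ)) := fun p _ => by
        split_ifs
        · exact map_one _
        · exact map_zero _
      simp only [map_mul, map_add, map_sub, e, FreeAlgebra.lift_ι_apply, Sum.elim_inr, Sum.elim_inl]
      exact contentOp_rep_swap hij k⟩

noncomputable instance : Module (GradedHecke N) (TableauModule σ N κ) :=
  Module.compHom _ (action σ N κ).toRingHom

theorem smul_def (h : GradedHecke N) (f : TableauModule σ N κ) : h • f = action σ N κ h f := rfl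

theorem algebraMap_smul (c : ℂ) (f : TableauModule σ N κ) :
    algebraMap ℂ (GradedHecke N) c • f = c • f := by
  rw [smul_def, AlgHom.commutes]
  rfl

theorem t_smul (w : Equiv.Perm (Fin N)) (f : TableauModule σ N κ) :
    GradedHecke.t w • f = rep w f := by
  rw [smul_def]
  congr 1
  unfold GradedHecke.t action
  erw [RingQuot.liftAlgHom_mkAlgHom_apply]
  simp

theorem x_smul (k : Fin N) (f : TableauModule σ N κ) :
    GradedHecke.x k • f = contentOp k f := by
  rw [smul_def]
  congr 1
  unfold GradedHecke.x action
  erw [RingQuot.liftAlgHom_mkAlgHom_apply]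
  simp

theorem coeff_t_swap_smul {i j : Fin N} (hij : (i : ℕ) + 1 = j) (f : TableauModule σ N κ) (T) :
    coeff (GradedHecke.t (Equiv.swap i j) • f) T = diagCoef (T i).1 (T j).1 * coeff f T +
      exchangeCoef (T i).1 (T j).1 * coeff f (exchange i j T) := by
  rw [t_smul, coeff_rep_swap hij, seminormal_apply]

theorem coeff_x_smul (k : Fin N) (f : TableauModule σ N κ) (T) :
    coeff (GradedHecke.x k • f) T = ((κ + diag (T k).1 : ℤ) : ℂ) * coeff f T := by
  rw [x_smul, coeff_contentOp]

/-! ### The basis of weight vectors -/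

open Classical in
/-- The basis vector of a standard tableau. -/
noncomputable def basisVec (T : Fin N ≃ σ.cells) (hT : IsStandard T) : TableauModule σ N κ :=
  ⟨fun U => if U = T then 1 else 0, fun U hU => if_neg fun e => hU (by rwa [e])⟩

open Classical in
theorem coeff_basisVec {T : Fin N ≃ σ.cells} (hT : IsStandard T) (U) :
    coeff (basisVec T hT : TableauModule σ N κ) U = if U = T then 1 else 0 := rfl

theorem basisVec_ne_zero {T : Fin N ≃ σ.cells} (hT : IsStandard T) :
    (basisVec T hT : TableauModule σ N κ) ≠ 0 := by
  intro h
  have := congrArg (fun f => coeff f T) h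
  simp [coeff_basisVec, coeff_zero] at this

theorem x_smul_basisVec {T : Fin N ≃ σ.cells} (hT : IsStandard T) (k : Fin N) :
    GradedHecke.x k • (basisVec T hT : TableauModule σ N κ) =
      algebraMap ℂ (GradedHecke N) ((κ + diag (T k).1 : ℤ) : ℂ) • basisVec T hT := by
  ext U
  rw [coeff_x_smul, algebraMap_smul, coeff_smul, coeff_basisVec]
  split_ifs with h
  · rw [h]
  · simp

/-- The `x_k` are diagonal in the tableau coordinates, so any tableau in the support of a weight
vector gives its weight. -/
theorem weights_eq : GradedHecke.weights (n := N) (TableauModule σ N κ) =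
    Set.range fun (T : {T : Fin N ≃ σ.cells // IsStandard T}) (k : Fin N) =>
      ((κ + diag (T.1 k).1 : ℤ) : ℂ) := by
  ext ν
  constructor
  · rintro ⟨f, hf, hν⟩
    obtain ⟨T, hT⟩ : ∃ T, coeff f T ≠ 0 := by
      by_contra! hc
      exact hf (ext hc)
    have hst : IsStandard T := by
      by_contra hc
      exact hT (coeff_mem f T hc)
    refine ⟨⟨T, hst⟩, funext fun k => ?_⟩
    have := congrArg (fun g => coeff g T) (hν k)
    rw [coeff_x_smul, algebraMap_smul, coeff_smul] at this
    exact mul_right_cancel₀ hT this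
  · rintro ⟨⟨T, hT⟩, rfl⟩
    exact ⟨(basisVec T hT : TableauModule σ N κ), basisVec_ne_zero hT, fun k => x_smul_basisVec hT k⟩

/-- The weights of the tableau module correspond to the standard tableaux. -/
theorem nonempty_weights_equiv : Nonempty (GradedHecke.weights (n := N) (TableauModule σ N κ) ≃
    {T : Fin N ≃ σ.cells // IsStandard T}) := by
  rw [weights_eq]
  refine ⟨(Equiv.ofInjective _ ?_).symm⟩
  rintro ⟨T, hT⟩ ⟨U, hU⟩ h
  refine Subtype.ext (hT.eq_of_diag_eq hU fun k => ?_)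
  have := congrFun h k
  simp only [Int.cast_inj] at this
  exact add_left_cancel this

/-- In a nonzero element of smallest support, two different tableaux would differ in some content.
Subtracting one of these contents from `x k` would kill one coordinate and keep the other. -/
theorem basisVec_mem_of_ne_zero (M : Submodule (GradedHecke N) (TableauModule σ N κ))
    (hM : M ≠ ⊥) : ∃ T, ∃ hT : IsStandard T, basisVec T hT ∈ M := by
  classical
  obtain ⟨f, hf, hmin⟩ := WellFounded.has_min
    (measure fun f : TableauModule σ N κ => (Finset.univ.filter fun T => coeff f T ≠ 0).card).wf
    {f | f ∈ M ∧ f ≠ 0} (by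
      obtain ⟨f, hf, h0⟩ := M.ne_bot_iff.1 hM
      exact ⟨f, hf, h0⟩)
  obtain ⟨T, hT⟩ : ∃ T, coeff f T ≠ 0 := by
    by_contra! hc
    exact hf.2 (ext hc)
  have hst : IsStandard T := by
    by_contra hc
    exact hT (coeff_mem f T hc)
  have huniq : ∀ U, coeff f U ≠ 0 → U = T := by
    intro U hU
    by_contra hne
    have hUst : IsStandard U := by
      by_contra hc
      exact hU (coeff_mem f U hc)
    obtain ⟨k, hk⟩ : ∃ k, diag (T k).1 ≠ diag (U k).1 := by
      by_contra! hc
      exact hne (hUst.eq_of_diag_eq hst fun k => (hc k).symm)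
    let g := (GradedHecke.x k - algebraMap ℂ (GradedHecke N) ((κ + diag (U k).1 : ℤ) : ℂ)) • f
    have hg : ∀ V, coeff g V = ((diag (V k).1 : ℂ) - diag (U k).1) * coeff f V := by
      intro V
      have : coeff g V = coeff (GradedHecke.x k • f) V - coeff (algebraMap ℂ (GradedHecke N)
          ((κ + diag (U k).1 : ℤ) : ℂ) • f) V := by
        simp only [g, sub_smul]
        rfl
      rw [this, coeff_x_smul, algebraMap_smul, coeff_smul]
      push_cast
      ring
    refine hmin g ⟨M.smul_mem _ hf.1, fun h0 => ?_⟩ ?_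
    · have := hg T
      rw [h0, coeff_zero] at this
      have h1 : (diag (T k).1 : ℂ) - diag (U k).1 ≠ 0 := sub_ne_zero.2 (by exact_mod_cast hk)
      exact mul_ne_zero h1 hT this.symm
    · refine Finset.card_lt_card (Finset.ssubset_iff_of_subset ?_ |>.2 ⟨U, ?_, ?_⟩)
      · intro V hV
        simp only [Finset.mem_filter, Finset.mem_univ, true_and, hg] at hV ⊢
        exact right_ne_zero_of_mul hV
      · simpa using hU
      · simp [hg]
  refine ⟨T, hst, ?_⟩
  have : basisVec T hst = algebraMap ℂ (GradedHecke N) (coeff f T)⁻¹ • f := by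
    ext U
    rw [coeff_basisVec, algebraMap_smul, coeff_smul]
    split_ifs with h
    · rw [h, inv_mul_cancel₀ hT]
    · rw [not_imp_comm.1 (huniq U) h, mul_zero]
  rw [this]
  exact M.smul_mem _ hf.1

/-- Subtracting its diagonal coefficient from the transposition sends one basis vector to a multiple
of the other. The factor is nonzero because the diagonals of the exchanged boxes do not differ by
`0` or `±1`. -/
theorem basisVec_mem_of_exchange (M : Submodule (GradedHecke N) (TableauModule σ N κ))
    {T : Fin N ≃ σ.cells} {i j : Fin N} (hij : (i : ℕ) + 1 = j) (hT : IsStandard T)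
    (hT' : IsStandard (exchange i j T)) (h : basisVec (exchange i j T) hT' ∈ M) :
    basisVec T hT ∈ M := by
  classical
  set U := exchange i j T with hU
  have hTU : T = exchange i j U := by rw [hU, exchange_exchange]
  have hne : T ≠ U := by
    intro e
    have := congrArg (fun V : Fin N ≃ σ.cells => V i) e
    simp [hU] at this
    omega
  have hc : exchangeCoef (T i).1 (T j).1 ≠ 0 := by
    rw [exchangeCoef]
    split_ifs
    · have hd := hT.diag_ne hij hT'
      have hd0 : diag (T i).1 ≠ diag (T j).1 := fun e => by
        have := hT.eq_of_diag_eq_of_close e (by omega) (by omega)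
        omega
      have h0 : (diag (T i).1 : ℂ) - diag (T j).1 ≠ 0 := sub_ne_zero.2 (by exact_mod_cast hd0)
      have h1 : (diag (T i).1 : ℂ) - diag (T j).1 - 1 ≠ 0 := by
        have : diag (T i).1 - diag (T j).1 - 1 ≠ 0 := by omega
        exact_mod_cast this
      have h2 : (diag (T i).1 : ℂ) - diag (T j).1 + 1 ≠ 0 := by
        have : diag (T i).1 - diag (T j).1 + 1 ≠ 0 := by omega
        exact_mod_cast this
      intro e
      rw [diagCoef] at e
      field_simp at e
      exact mul_ne_zero h1 h2 (by linear_combination e)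
    · exact one_ne_zero
  have key : (basisVec T hT : TableauModule σ N κ) = algebraMap ℂ (GradedHecke N) (exchangeCoef (T i).1 (T j).1)⁻¹ •
      ((GradedHecke.t (Equiv.swap i j) -
        algebraMap ℂ (GradedHecke N) (diagCoef (U i).1 (U j).1)) • basisVec U hT') := by
    ext V
    have e : coeff ((GradedHecke.t (Equiv.swap i j) -
        algebraMap ℂ (GradedHecke N) (diagCoef (U i).1 (U j).1)) •
          (basisVec U hT' : TableauModule σ N κ)) V =
        coeff (GradedHecke.t (Equiv.swap i j) • (basisVec U hT' : TableauModule σ N κ)) V -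
        coeff (algebraMap ℂ (GradedHecke N) (diagCoef (U i).1 (U j).1) •
          (basisVec U hT' : TableauModule σ N κ)) V := by
      rw [sub_smul]
      rfl
    rw [algebraMap_smul, coeff_smul, e, coeff_t_swap_smul hij, algebraMap_smul, coeff_smul,
      coeff_basisVec, coeff_basisVec, coeff_basisVec]
    by_cases h1 : V = T
    · subst h1
      rw [if_pos rfl, if_neg hne, if_pos rfl]
      field_simp
      ring
    · have h3 : exchange i j V ≠ U := fun e => h1 (by rw [hTU, ← e, exchange_exchange])
      rw [if_neg h1, if_neg h3]
      split_ifs with h4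
      · rw [h4]
        ring
      · ring
  rw [key]
  exact M.smul_mem _ (M.smul_mem _ h)

theorem eq_sum_basisVec (f : TableauModule σ N κ) [Fintype {T : Fin N ≃ σ.cells // IsStandard T}] :
    f = ∑ T : {T : Fin N ≃ σ.cells // IsStandard T},
      algebraMap ℂ (GradedHecke N) (coeff f T.1) • basisVec T.1 T.2 := by
  classical
  ext U
  have hsum : ∀ (s : Finset {T : Fin N ≃ σ.cells // IsStandard T})
      (g : {T : Fin N ≃ σ.cells // IsStandard T} → TableauModule σ N κ),
      coeff (∑ T ∈ s, g T) U = ∑ T ∈ s, coeff (g T) U := by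
    intro s g
    induction s using Finset.induction_on with
    | empty => simp [coeff_zero]
    | insert a s ha ih => rw [Finset.sum_insert ha, Finset.sum_insert ha, coeff_add, ih]
  rw [hsum]
  simp only [algebraMap_smul, coeff_smul, coeff_basisVec]
  by_cases hU : IsStandard U
  · rw [Finset.sum_eq_single ⟨U, hU⟩]
    · simp
    · rintro ⟨V, hV⟩ _ hne
      rw [if_neg fun e => hne (Subtype.ext e.symm), mul_zero]
    · simp
  · rw [coeff_mem f U hU]
    refine (Finset.sum_eq_zero fun V _ => ?_).symm
    rw [if_neg fun e => hU (by rw [e]; exact V.2), mul_zero]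

/-- The tableau module is irreducible. -/
theorem isSimpleModule {T₀ : Fin N ≃ σ.cells} (hT₀ : IsStandard T₀) :
    IsSimpleModule (GradedHecke N) (TableauModule σ N κ) := by
  classical
  have : Nontrivial (TableauModule σ N κ) := ⟨⟨_, _, basisVec_ne_zero hT₀⟩⟩
  rw [isSimpleModule_iff]
  refine ⟨fun M => ?_⟩
  rw [or_iff_not_imp_left]
  intro hM
  obtain ⟨T, hT, hmem⟩ := basisVec_mem_of_ne_zero M hM
  have hall : ∀ U, ∀ hU : IsStandard U, basisVec U hU ∈ M := by
    intro U hU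
    have := hT.exchange_induction (motive := fun U => ∀ hU : IsStandard U, basisVec U hU ∈ M)
      (fun _ => hmem)
      (fun V i j hij hV hV' ih _ => basisVec_mem_of_exchange M hij hV hV' (ih hV')) hU
    exact this hU
  rw [eq_top_iff]
  intro f _
  rw [eq_sum_basisVec f]
  exact M.sum_mem fun U _ => M.smul_mem _ (hall _ _)

end TableauModule

end SkewDiagram

/-! ## Langlands quotients of induced modules -/

namespace GradedHecke

variable {n : ℕ}

theorem t_one : (t 1 : GradedHecke n) = 1 := by
  have := RingQuot.mkAlgHom_rel ℂ (HeckeRel.t_one (n := n))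
  rw [map_one] at this
  exact this

theorem t_mul (u w : Equiv.Perm (Fin n)) : (t (u * w) : GradedHecke n) = t u * t w := by
  have := RingQuot.mkAlgHom_rel ℂ (HeckeRel.t_mul u w)
  rw [map_mul] at this
  exact this

theorem x_comm (i j : Fin n) : (x i * x j : GradedHecke n) = x j * x i := by
  have := RingQuot.mkAlgHom_rel ℂ (HeckeRel.x_comm i j)
  rw [map_mul, map_mul] at this
  exact this

theorem x_mul_t_swap {i j : Fin n} (hij : (i : ℕ) + 1 = j) (k : Fin n) :
    (x k * t (Equiv.swap i j) : GradedHecke n) =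
      t (Equiv.swap i j) * x (Equiv.swap i j k) +
        algebraMap ℂ _ ((if k = i then 1 else 0) - (if k = j then 1 else 0)) := by
  have := RingQuot.mkAlgHom_rel ℂ (HeckeRel.cross i j k hij)
  have e : ∀ p : Prop, [Decidable p] → RingQuot.mkAlgHom ℂ (HeckeRel n) (if p then 1 else 0) =
      algebraMap ℂ _ (if p then 1 else 0) := fun p _ => by split_ifs <;> simp
  rw [map_add, map_mul, map_mul, map_sub, e, e, ← map_sub] at this
  exact this

theorem mem_of_generators (S : Subalgebra ℂ (GradedHecke n)) (ht : ∀ w, t w ∈ S)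
    (hx : ∀ k, x k ∈ S) (h : GradedHecke n) : h ∈ S := by
  obtain ⟨y, rfl⟩ := RingQuot.mkAlgHom_surjective ℂ (HeckeRel n) h
  induction y using FreeAlgebra.induction with
  | grade0 r =>
    rw [AlgHom.commutes]
    exact S.algebraMap_mem r
  | grade1 y =>
    rcases y with w | k
    · exact ht w
    · exact hx k
  | mul a b ha hb =>
    rw [map_mul]
    exact S.mul_mem ha hb
  | add a b ha hb =>
    rw [map_add]
    exact S.add_mem ha hb

theorem weights_congr {X Y : Type*} [AddCommGroup X] [AddCommGroup Y] [Module (GradedHecke n) X]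
    [Module (GradedHecke n) Y] (e : X ≃ₗ[GradedHecke n] Y) :
    weights (n := n) X = weights (n := n) Y := by
  ext ν
  constructor
  · rintro ⟨v, hv, h⟩
    exact ⟨e v, by simpa using hv, fun i => by rw [← map_smul, h, map_smul]⟩
  · rintro ⟨v, hv, h⟩
    exact ⟨e.symm v, by simpa using hv, fun i => by rw [← map_smul, h, map_smul]⟩

variable (n) in
/-- The commutative subalgebra `𝔸` generated by the `x_i`. -/
noncomputable def polySubalgebra : Subalgebra ℂ (GradedHecke n) := Algebra.adjoin ℂ (Set.range x)

theorem x_mem_polySubalgebra (k : Fin n) : x k ∈ polySubalgebra n :=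
  Algebra.subset_adjoin ⟨k, rfl⟩

theorem polySubalgebra_comm {y z : GradedHecke n} (hy : y ∈ polySubalgebra n)
    (hz : z ∈ polySubalgebra n) : y * z = z * y := by
  have h1 : ∀ k, Commute (x k) z := fun k =>
    Algebra.commute_of_mem_adjoin_of_forall_mem_commute hz (by
      rintro _ ⟨l, rfl⟩
      exact x_comm k l)
  exact (Algebra.commute_of_mem_adjoin_of_forall_mem_commute hy (by
    rintro _ ⟨l, rfl⟩
    exact (h1 l).symm)).symm.eq

end GradedHecke

namespace Multisegment

open GradedHecke

variable (Δ : Multisegment)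

/-- The canonical generator of the induced module. -/
noncomputable def gen : Δ.Induced := Submodule.Quotient.mk 1

theorem smul_gen (h : GradedHecke Δ.size) : h • Δ.gen = Submodule.Quotient.mk h := by
  rw [gen, ← Submodule.Quotient.mk_smul, smul_eq_mul, mul_one]

theorem x_smul_gen (p : Fin Δ.size) :
    x p • Δ.gen = algebraMap ℂ (GradedHecke Δ.size) (Δ.entry p : ℂ) • Δ.gen := by
  rw [smul_gen, smul_gen, Submodule.Quotient.eq]
  exact Submodule.subset_span (Or.inl ⟨p, rfl⟩)

theorem t_smul_gen {w : Equiv.Perm (Fin Δ.size)} (hw : ∀ p, Δ.block (w p) = Δ.block p) :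
    t w • Δ.gen = algebraMap ℂ (GradedHecke Δ.size) ((Equiv.Perm.sign w : ℤ) : ℂ) • Δ.gen := by
  rw [smul_gen, smul_gen, Submodule.Quotient.eq]
  exact Submodule.subset_span (Or.inr ⟨w, hw, rfl⟩)

/-- The span of the `t_w` with fewer than `m` inversions, applied to the generator. -/
noncomputable def lowSpan (m : ℕ) : Submodule ℂ Δ.Induced :=
  Submodule.span ℂ {u | ∃ w : Equiv.Perm (Fin Δ.size), w.invCount < m ∧ u = t w • Δ.gen}

theorem t_smul_gen_mem_lowSpan {w : Equiv.Perm (Fin Δ.size)} {m : ℕ} (h : w.invCount < m) :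
    t w • Δ.gen ∈ Δ.lowSpan m := Submodule.subset_span ⟨w, h, rfl⟩

theorem t_swap_smul_mem_lowSpan {i j : Fin Δ.size} (hij : (i : ℕ) + 1 = j) {m : ℕ}
    {u : Δ.Induced} (hu : u ∈ Δ.lowSpan m) : t (Equiv.swap i j) • u ∈ Δ.lowSpan (m + 1) := by
  induction hu using Submodule.span_induction with
  | mem u hu =>
    obtain ⟨w, hw, rfl⟩ := hu
    rw [← mul_smul, ← t_mul]
    have := Equiv.Perm.invCount_swap_mul_le hij w
    exact Δ.t_smul_gen_mem_lowSpan (by omega)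
  | zero => simp
  | add u v _ _ hu hv =>
    rw [smul_add]
    exact Submodule.add_mem _ hu hv
  | smul c u _ hu =>
    rw [smul_comm]
    exact Submodule.smul_mem _ c hu

/-- The `x_k` act on the `t_w` by triangular operators. -/
theorem x_smul_t_smul_gen (k : Fin Δ.size) (w : Equiv.Perm (Fin Δ.size)) :
    x k • t w • Δ.gen - (Δ.entry (w⁻¹ k) : ℂ) • t w • Δ.gen ∈ Δ.lowSpan w.invCount := by
  induction hm : w.invCount using Nat.strong_induction_on generalizing w k with
  | _ m ih =>
    by_cases hw : w = 1
    · subst hw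
      rw [t_one, one_smul, x_smul_gen, algebraMap_smul]
      simp
    · obtain ⟨i, j, hij, hlt⟩ := Equiv.Perm.exists_descent (inv_ne_one.2 hw)
      have hcount := Equiv.Perm.invCount_swap_mul hij hlt
      set w' := Equiv.swap i j * w with hw'
      have hww : w = Equiv.swap i j * w' := by rw [hw', Equiv.swap_mul_self_mul]
      have h1 := ih _ (by omega) (Equiv.swap i j k) w' rfl
      have h2 := Δ.t_swap_smul_mem_lowSpan hij h1
      have e : w'⁻¹ (Equiv.swap i j k) = w⁻¹ k := by
        rw [hw', mul_inv_rev, Equiv.swap_inv]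
        simp
      rw [hcount, hm, e] at h2
      have h3 : t w' • Δ.gen ∈ Δ.lowSpan m := Δ.t_smul_gen_mem_lowSpan (by omega)
      -- Write `w` as `swap i j * w'` with `w'` shorter, and move `x k` past the transposition; the
      -- correction is a multiple of `t w' • gen`.
      have key : x k • t w • Δ.gen - (Δ.entry (w⁻¹ k) : ℂ) • t w • Δ.gen =
          t (Equiv.swap i j) • (x (Equiv.swap i j k) • t w' • Δ.gen -
            (Δ.entry (w⁻¹ k) : ℂ) • t w' • Δ.gen) +
          ((if k = i then 1 else 0) - (if k = j then 1 else 0) : ℂ) • t w' • Δ.gen := by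
        conv_lhs => rw [hww, t_mul]
        rw [← hww, mul_smul, ← mul_smul (x k), x_mul_t_swap hij, add_smul, mul_smul,
          algebraMap_smul, smul_sub, smul_comm (t (Equiv.swap i j)) (Δ.entry (w⁻¹ k) : ℂ)]
        abel
      rw [key]
      exact Submodule.add_mem _ h2 (Submodule.smul_mem _ _ h3)

/-- The elements that some element of `𝔸`, which does not annihilate the generator, moves into the
line of the generator. -/
noncomputable def lineSubmodule : Submodule ℂ Δ.Induced where
  carrier := {u | ∃ z ∈ polySubalgebra Δ.size, (∃ c : ℂ, c ≠ 0 ∧ z • Δ.gen = c • Δ.gen) ∧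
    ∃ d : ℂ, z • u = d • Δ.gen}
  zero_mem' := ⟨1, one_mem _, ⟨1, one_ne_zero, by simp⟩, 0, by simp⟩
  add_mem' := by
    rintro u u' ⟨z, hz, ⟨c, hc, hzc⟩, d, hd⟩ ⟨z', hz', ⟨c', hc', hzc'⟩, d', hd'⟩
    -- The product serves both vectors because `𝔸` is commutative.
    refine ⟨z * z', mul_mem hz hz', ⟨c' * c, mul_ne_zero hc' hc, ?_⟩, c' * d + c * d', ?_⟩
    · rw [mul_smul, hzc', smul_comm, hzc, smul_smul]
    · rw [smul_add, mul_smul z z' u', hd', polySubalgebra_comm hz hz', mul_smul, hd, smul_comm z',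
        smul_comm z, hzc, hzc', smul_smul, smul_smul, ← add_smul]
      congr 1
      ring
  smul_mem' := by
    rintro a u ⟨z, hz, hc, d, hd⟩
    exact ⟨z, hz, hc, a * d, by rw [smul_comm, hd, smul_smul]⟩

variable {Δ} in
theorem exists_adjacent_descent {w : Equiv.Perm (Fin Δ.size)}
    (hw : ¬∀ p q, p < q → Δ.block p = Δ.block q → w p < w q) :
    ∃ i j : Fin Δ.size, (i : ℕ) + 1 = j ∧ Δ.block i = Δ.block j ∧ w j < w i := by
  by_contra! hc
  refine hw fun p q hpq hb => ?_
  induction hd : (q : ℕ) - p using Nat.strong_induction_on generalizing p q with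
  | _ m ih =>
    rw [Fin.lt_def] at hpq
    have hlt : (q : ℕ) - 1 < Δ.size := by omega
    set r : Fin Δ.size := ⟨q - 1, hlt⟩ with hr
    have hrq : (r : ℕ) + 1 = q := by simp [hr]; omega
    have hpr : p ≤ r := by rw [Fin.le_def]; omega
    have hbr : Δ.block r = Δ.block q := by
      refine le_antisymm (Δ.block_mono (by rw [Fin.le_def]; omega)) ?_
      rw [← hb]
      exact Δ.block_mono hpr
    have h1 : w r < w q := lt_of_le_of_ne (hc r q hrq hbr) fun e => by
      have := w.injective e
      rw [← this] at hrq
      omega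
    rcases hpr.eq_or_lt with e | hlt'
    · rwa [e]
    · exact (ih _ (by omega) p r hlt' (hb.trans hbr.symm) rfl).trans h1

theorem block_swap {i j : Fin Δ.size} (hb : Δ.block i = Δ.block j) (p : Fin Δ.size) :
    Δ.block (Equiv.swap i j p) = Δ.block p := by
  rw [Equiv.swap_apply_def]
  split_ifs with h1 h2
  · rw [h1, hb]
  · rw [h2, hb]
  · rfl

/-- If `w` has a descent inside a block, the generator absorbs that transposition as a sign and `w`
gets shorter. Otherwise `w` is increasing on blocks, and unless it is the identity its leading
weight differs from that of the generator. -/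
theorem t_smul_gen_mem_lineSubmodule (hlo : StrictAnti Δ.lo) (w : Equiv.Perm (Fin Δ.size)) :
    t w • Δ.gen ∈ Δ.lineSubmodule := by
  induction hm : w.invCount using Nat.strong_induction_on generalizing w with
  | _ m ih =>
    by_cases hinc : ∀ p q, p < q → Δ.block p = Δ.block q → w p < w q
    · by_cases hw : w = 1
      · rw [hw, t_one, one_smul]
        exact ⟨1, one_mem _, ⟨1, one_ne_zero, by simp⟩, 1, by simp⟩
      · obtain ⟨p, hp⟩ : ∃ p, Δ.entry (w p) ≠ Δ.entry p := by
          by_contra! hc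
          exact hw (Δ.eq_one_of_entry_eq hlo hinc hc)
        have hle : Δ.lowSpan w.invCount ≤ Δ.lineSubmodule := Submodule.span_le.2 (by
          rintro _ ⟨u, hu, rfl⟩
          exact ih _ (hm ▸ hu) u rfl)
        obtain ⟨z, hz, ⟨c, hc, hzc⟩, d, hd⟩ := hle (Δ.x_smul_t_smul_gen (w p) w)
        have hq : w⁻¹ (w p) = p := by simp
        rw [hq] at hd
        -- The new factor removes the leading term of `t w • gen`, leaving a combination of shorter
        -- terms for `z`. On the generator it acts by the nonzero number `entry (w p) - entry p`.
        refine ⟨z * (x (w p) - algebraMap ℂ _ (Δ.entry p : ℂ)), mul_mem hz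
          (sub_mem (x_mem_polySubalgebra _) (Subalgebra.algebraMap_mem _ _)),
          ⟨((Δ.entry (w p) : ℂ) - Δ.entry p) * c, mul_ne_zero
            (sub_ne_zero.2 (by exact_mod_cast hp)) hc, ?_⟩, d, ?_⟩
        · rw [mul_smul, sub_smul, x_smul_gen, algebraMap_smul, algebraMap_smul, ← sub_smul,
            smul_comm, hzc, smul_smul]
        · rw [mul_smul, sub_smul, algebraMap_smul, hd]
    · obtain ⟨i, j, hij, hb, hlt⟩ := exists_adjacent_descent hinc
      have hcount := Equiv.Perm.invCount_mul_swap hij hlt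
      have hne : i ≠ j := by rintro rfl; omega
      have h1 := ih _ (by omega) (w * Equiv.swap i j) rfl
      have h2 : t w • Δ.gen = (-1 : ℂ) • t (w * Equiv.swap i j) • Δ.gen := by
        conv_lhs => rw [show w = w * Equiv.swap i j * Equiv.swap i j by
          rw [mul_assoc, Equiv.swap_mul_self, mul_one]]
        rw [t_mul (w * Equiv.swap i j), mul_smul, t_smul_gen _ (Δ.block_swap hb),
          Equiv.Perm.sign_swap hne, algebraMap_smul, smul_comm]
        simp
      rw [h2]
      exact Submodule.smul_mem _ _ h1

/-- The span of the vectors `t w • gen` is stable under all `t` and `x`, hence is everything. In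
effect the generator spans the whole generalized weight space of its weight. -/
theorem lineSubmodule_eq_top (hlo : StrictAnti Δ.lo) : Δ.lineSubmodule = ⊤ := by
  set S : Submodule ℂ Δ.Induced := Submodule.span ℂ (Set.range fun w : Equiv.Perm (Fin Δ.size) => t w • Δ.gen) with hS
  have hlow : ∀ m, Δ.lowSpan m ≤ S := fun m => Submodule.span_mono (by
    rintro _ ⟨w, _, rfl⟩
    exact ⟨w, rfl⟩)
  let A : Subalgebra ℂ (GradedHecke Δ.size) :=
    { carrier := {h | ∀ u ∈ S, h • u ∈ S}
      mul_mem' := fun {a b} ha hb u hu => by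
        rw [mul_smul]
        exact ha _ (hb _ hu)
      add_mem' := fun {a b} ha hb u hu => by
        rw [add_smul]
        exact S.add_mem (ha _ hu) (hb _ hu)
      algebraMap_mem' := fun c u hu => by
        rw [algebraMap_smul]
        exact S.smul_mem _ hu }
  have hA : ∀ h : GradedHecke Δ.size, (∀ w : Equiv.Perm (Fin Δ.size), h • t w • Δ.gen ∈ S) → h ∈ A := by
    intro h hh u hu
    induction hu using Submodule.span_induction with
    | mem u hu =>
      obtain ⟨w, rfl⟩ := hu
      exact hh w
    | zero => simp
    | add u v _ _ hu hv =>
      rw [smul_add]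
      exact S.add_mem hu hv
    | smul c u _ hu =>
      rw [smul_comm]
      exact S.smul_mem c hu
  have htop : ∀ h : GradedHecke Δ.size, h ∈ A := by
    refine mem_of_generators A (fun u => hA _ fun w => ?_) fun k => hA _ fun w => ?_
    · rw [← mul_smul, ← t_mul]
      exact Submodule.subset_span ⟨_, rfl⟩
    · have := S.add_mem (hlow _ (Δ.x_smul_t_smul_gen k w)) (S.smul_mem (Δ.entry (w⁻¹ k) : ℂ)
        (Submodule.subset_span ⟨w, rfl⟩))
      rwa [sub_add_cancel] at this
  have hgen : Δ.gen ∈ S := Submodule.subset_span ⟨1, by simp only [t_one, one_smul]⟩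
  rw [eq_top_iff]
  intro u _
  obtain ⟨h, rfl⟩ := Submodule.Quotient.mk_surjective _ u
  rw [← smul_gen]
  refine (Submodule.span_le.2 ?_ : S ≤ Δ.lineSubmodule) (htop h _ hgen)
  rintro _ ⟨w, rfl⟩
  exact Δ.t_smul_gen_mem_lineSubmodule hlo w

/-- A simple module that contains the inducing character is the Langlands quotient, if the
beginnings of the segments decrease strictly. -/
theorem nonempty_langlandsQuotient_equiv (hlo : StrictAnti Δ.lo) {C : Type*} [AddCommGroup C]
    [Module (GradedHecke Δ.size) C] [IsSimpleModule (GradedHecke Δ.size) C] {v : C} (hv : v ≠ 0)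
    (hx : ∀ p, x p • v = algebraMap ℂ (GradedHecke Δ.size) (Δ.entry p : ℂ) • v)
    (ht : ∀ w : Equiv.Perm (Fin Δ.size), (∀ p, Δ.block (w p) = Δ.block p) →
      t w • v = algebraMap ℂ (GradedHecke Δ.size) ((Equiv.Perm.sign w : ℤ) : ℂ) • v) :
    Nonempty (Δ.LanglandsQuotient ≃ₗ[GradedHecke Δ.size] C) := by
  have hle : Δ.leftIdeal ≤ LinearMap.ker (LinearMap.toSpanSingleton (GradedHecke Δ.size) C v) := by
    refine Submodule.span_le.2 ?_
    rintro _ (⟨p, rfl⟩ | ⟨w, hw, rfl⟩)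
    · simp [sub_smul, hx]
    · simp [sub_smul, ht w hw]
  let π : Δ.Induced →ₗ[GradedHecke Δ.size] C := Δ.leftIdeal.liftQ _ hle
  have hgen : π Δ.gen = v := by
    change LinearMap.toSpanSingleton (GradedHecke Δ.size) C v 1 = v
    simp
  have hsurj : Function.Surjective π := by
    intro c
    obtain ⟨h, rfl⟩ := IsSimpleModule.toSpanSingleton_surjective (GradedHecke Δ.size) hv c
    exact ⟨h • Δ.gen, by rw [map_smul, hgen]; rfl⟩
  have hker : Module.jacobson (GradedHecke Δ.size) Δ.Induced = LinearMap.ker π := by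
    have e := π.quotKerEquivOfSurjective hsurj
    have hsimple : IsSimpleModule (GradedHecke Δ.size) (Δ.Induced ⧸ LinearMap.ker π) :=
      IsSimpleModule.congr e
    have hco := isSimpleModule_iff_isCoatom.1 hsimple
    refine le_antisymm (sInf_le hco) (le_sInf fun M hM => ?_)
    -- If `π m ≠ 0` with `m ∈ M`, some `h` gives `π (h • m) = v`. An element `z` moves `h • m - gen`
    -- to `d • gen`, and applying `π` shows `d = 0`. So `z • gen`, a nonzero multiple of the
    -- generator, lies in `M`, and `M` is everything.
    have hM' : M ≤ LinearMap.ker π := by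
      intro m hm
      by_contra hne
      obtain ⟨h, hh⟩ := IsSimpleModule.toSpanSingleton_surjective (GradedHecke Δ.size)
        (show π m ≠ 0 from hne) v
      rw [LinearMap.toSpanSingleton_apply] at hh
      obtain ⟨z, -, ⟨c, hc, hzc⟩, d, hd⟩ : h • m - Δ.gen ∈ Δ.lineSubmodule := by
        rw [Δ.lineSubmodule_eq_top hlo]
        trivial
      have h0 : algebraMap ℂ (GradedHecke Δ.size) d • v = 0 := by
        rw [← hgen, ← map_smul, algebraMap_smul, ← hd, map_smul, map_sub, map_smul, hh, hgen,
          sub_self, smul_zero]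
      have hd0 : d = 0 := by
        by_contra hd0
        refine hv ?_
        rw [← one_smul (GradedHecke Δ.size) v, ← map_one (algebraMap ℂ (GradedHecke Δ.size)),
          ← inv_mul_cancel₀ hd0, map_mul, mul_smul, h0, smul_zero]
      rw [hd0, zero_smul, smul_sub, sub_eq_zero] at hd
      have hmem : Δ.gen ∈ M := by
        have h1 : c • Δ.gen ∈ M := by
          rw [← hzc, ← hd]
          exact M.smul_mem _ (M.smul_mem _ hm)
        have h2 := M.smul_mem (algebraMap ℂ (GradedHecke Δ.size) c⁻¹) h1
        rwa [algebraMap_smul, smul_smul, inv_mul_cancel₀ hc, one_smul] at h2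
      refine hM.1 (eq_top_iff.2 fun u _ => ?_)
      obtain ⟨y, rfl⟩ := Submodule.Quotient.mk_surjective _ u
      rw [← smul_gen]
      exact M.smul_mem _ hmem
    rcases hM'.eq_or_lt with h | h
    · exact h.ge
    · exact absurd (hM.2 _ h) hco.1
  exact ⟨(Submodule.quotEquivOfEq _ _ hker).trans (π.quotKerEquivOfSurjective hsurj)⟩

end Multisegment

/-! ### The ladder representation is the tableau module -/

namespace SkewDiagram

open GradedHecke TableauModule

variable {σ : SkewDiagram}

/-- Consecutive numbers in a block occupy horizontal neighbours. There the diagonal coefficient is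
`-1` and the exchange term vanishes, which gives the sign. -/
theorem t_smul_basisVec_rowTableau (a κ : ℤ) {w : Equiv.Perm (Fin (σ.multisegment a).size)}
    (hw : ∀ p, (σ.multisegment a).block (w p) = (σ.multisegment a).block p) :
    t w • (basisVec (σ.rowTableau a) (rowTableau_isStandard a) : TableauModule σ _ κ) =
      algebraMap ℂ (GradedHecke (σ.multisegment a).size) ((Equiv.Perm.sign w : ℤ) : ℂ) •
        (basisVec (σ.rowTableau a) (rowTableau_isStandard a) : TableauModule σ _ κ) := by
  induction w using Equiv.Perm.descent_induction with
  | one => simp [t_one]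
  | step w i j hij hlt ih =>
    have hne : i ≠ j := by rintro rfl; omega
    -- The blocks are ordered intervals and `w` preserves each of them, so a descent lies inside one
    -- block.
    have hb : (σ.multisegment a).block i = (σ.multisegment a).block j := by
      refine le_antisymm ((σ.multisegment a).block_mono (by rw [Fin.le_def]; omega)) ?_
      rw [← hw i, ← hw j]
      exact (σ.multisegment a).block_mono hlt.le
    have hswap : t (Equiv.swap i j) •
        (basisVec (σ.rowTableau a) (rowTableau_isStandard a) : TableauModule σ _ κ) =
        algebraMap ℂ (GradedHecke (σ.multisegment a).size) (-1) •
          (basisVec (σ.rowTableau a) (rowTableau_isStandard a) : TableauModule σ _ κ) := by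
      classical
      have heast := rowTableau_east a hij hb
      ext U
      rw [coeff_t_swap_smul hij, algebraMap_smul, coeff_smul, coeff_basisVec, coeff_basisVec]
      by_cases h1 : U = σ.rowTableau a
      · have h2 : exchange i j U ≠ σ.rowTableau a := by
          intro e
          rw [h1] at e
          have := congrArg (fun V : _ ≃ σ.cells => V i) e
          simp at this
          exact hne this.symm
        rw [if_pos h1, if_neg h2, h1, diagCoef_of_east heast]
        ring
      · rw [if_neg h1]
        by_cases h2 : exchange i j U = σ.rowTableau a
        · have h3 : U = exchange i j (σ.rowTableau a) := by rw [← h2, exchange_exchange]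
          have h4 : exchangeCoef (U i).1 (U j).1 = 0 := by
            rw [h3]
            simp only [exchange, Equiv.trans_apply, Equiv.swap_apply_left, Equiv.swap_apply_right]
            exact exchangeCoef_of_arrow (Or.inl heast)
          rw [h4]
          ring
        · rw [if_neg h2]
          ring
    have ih := ih fun p => by
      rw [Equiv.Perm.mul_apply, hw, Multisegment.block_swap _ hb]
    conv_lhs => rw [show w = w * Equiv.swap i j * Equiv.swap i j by
      rw [mul_assoc, Equiv.swap_mul_self, mul_one]]
    rw [t_mul (w * Equiv.swap i j), mul_smul, hswap, ← mul_smul, ← Algebra.commutes, mul_smul, ih,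
      ← mul_smul, ← map_mul, Equiv.Perm.sign_mul, Equiv.Perm.sign_swap hne]
    congr 2
    push_cast
    ring

theorem nonempty_ladder_equiv (hσ : σ.Connected) (a : ℤ) :
    Nonempty (σ.Ladder a ≃ₗ[GradedHecke (σ.multisegment a).size]
      TableauModule σ (σ.multisegment a).size (σ.contentShift hσ a)) := by
  have := TableauModule.isSimpleModule (κ := σ.contentShift hσ a)
    (rowTableau_isStandard (σ := σ) a)
  refine (σ.multisegment a).nonempty_langlandsQuotient_equiv (multisegment_lo_strictAnti σ a)
    (basisVec_ne_zero (rowTableau_isStandard a)) (fun p => ?_) fun w hw =>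
      t_smul_basisVec_rowTableau a _ hw
  rw [entry_eq hσ]
  exact x_smul_basisVec (rowTableau_isStandard a) p

/-- Ladder representations are irreducible. -/
theorem isSimpleModule_ladder (hσ : σ.Connected) (a : ℤ) :
    IsSimpleModule (GradedHecke (σ.multisegment a).size) (σ.Ladder a) := by
  obtain ⟨e⟩ := nonempty_ladder_equiv hσ a
  have := TableauModule.isSimpleModule (κ := σ.contentShift hσ a)
    (rowTableau_isStandard (σ := σ) a)
  exact IsSimpleModule.congr e

/-- The weights of a ladder representation correspond to the standard tableaux. -/
theorem nonempty_weights_ladder_equiv (hσ : σ.Connected) (a : ℤ) :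
    Nonempty (weights (n := (σ.multisegment a).size) (σ.Ladder a) ≃
      {T : Fin (σ.multisegment a).size ≃ σ.cells // IsStandard T}) := by
  obtain ⟨e⟩ := nonempty_ladder_equiv hσ a
  rw [weights_congr e]
  exact TableauModule.nonempty_weights_equiv

end SkewDiagram

/-! ## Algebras with a character that detects idempotents -/

open Polynomial in
/-- If a character of an algebra vanishes on no nonzero idempotent, then it detects units. -/
theorem isUnit_of_character_ne_zero {K E : Type*} [Field K] [Ring E] [Algebra K E]
    (ε : E →ₐ[K] K) (hε : ∀ e : E, IsIdempotentElem e → ε e = 0 → e = 0) {f : E}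
    (hint : IsIntegral K f) (hf : ε f ≠ 0) : IsUnit f := by
  set c := ε f with hc
  have hev : ∀ p : K[X], ε (aeval f p) = p.eval c := fun p => by
    rw [← aeval_algHom_apply, coe_aeval_eq_eval]
  have hm := minpoly.ne_zero hint
  obtain ⟨q, hq, hndvd⟩ := exists_eq_pow_rootMultiplicity_mul_and_not_dvd (minpoly K f) hm c
  set k := rootMultiplicity c (minpoly K f) with hk
  have hroot : (minpoly K f).IsRoot c := by
    rw [IsRoot.def, ← hev, minpoly.aeval, map_zero]
  have hk0 : k ≠ 0 := ((rootMultiplicity_pos hm).2 hroot).ne'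
  -- By this Bézout relation `a * (X - C c) ^ k` is idempotent modulo the minimal polynomial. The
  -- character kills its value at `f`, so that value is zero and `f` is `c` plus a nilpotent.
  obtain ⟨a, b, hab⟩ : IsCoprime ((X - C c) ^ k) q :=
    ((irreducible_X_sub_C c).coprime_iff_not_dvd.2 hndvd).pow_left
  have hzero : aeval f (a * (X - C c) ^ k) = 0 := by
    refine hε _ ?_ ?_
    · have h1 : a * (X - C c) ^ k * (a * (X - C c) ^ k) =
          a * (X - C c) ^ k - a * b * minpoly K f := by
        rw [hq]
        linear_combination (a * (X - C c) ^ k) * hab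
      rw [IsIdempotentElem, ← map_mul, h1, map_sub, map_mul _ (a * b), minpoly.aeval, mul_zero,
        sub_zero]
    · rw [hev]
      simp [hk0]
  have hone : aeval f (b * q) = 1 := by
    have := congrArg (aeval f) hab
    rwa [map_add, hzero, zero_add, map_one] at this
  have hnil : IsNilpotent (f - algebraMap K E c) := by
    refine ⟨k, ?_⟩
    have h1 : aeval f (minpoly K f * b) = (f - algebraMap K E c) ^ k := by
      conv_lhs => rw [hq]
      rw [show (X - C c) ^ k * q * b = (X - C c) ^ k * (b * q) by ring, map_mul, hone, mul_one]
      simp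
    rw [← h1, map_mul, minpoly.aeval, zero_mul]
  have hu : IsUnit (algebraMap K E c) := (IsUnit.mk0 c hf).map (algebraMap K E)
  have := hnil.isUnit_add_left_of_commute hu (Algebra.commutes c _).symm
  rwa [add_sub_cancel] at this

/-! ## The centralizer of a distinguished nilpotent pair -/

namespace SkewDiagram

variable {σ : SkewDiagram} (φ : σ.cells ≃ Fin σ.size)

/-- The box with a given label. -/
def box (p : Fin σ.size) : ℕ × ℕ := (φ.symm p).1

theorem box_injective : Function.Injective (box φ) :=
  Subtype.val_injective.comp φ.symm.injective

/-- The relation `R` moves every box by the fixed translation `s`. -/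
structure IsShift (R : ℕ × ℕ → ℕ × ℕ → Prop) (s : ℕ × ℕ) : Prop where
  iff : ∀ c d, R c d ↔ d = c + s

theorem isShift_east : IsShift East (0, 1) := ⟨fun _ _ => Iff.rfl⟩

theorem isShift_south : IsShift South (1, 0) := ⟨fun _ _ => Iff.rfl⟩

variable {φ} {R : ℕ × ℕ → ℕ × ℕ → Prop} {s : ℕ × ℕ}

theorem moveMatrix_apply (p q : Fin σ.size) [Decidable (R (box φ q) (box φ p))] :
    σ.moveMatrix φ R p q = if R (box φ q) (box φ p) then 1 else 0 := by
  unfold moveMatrix box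
  simp only [Matrix.of_apply]
  congr

theorem mul_moveMatrix_apply (hR : IsShift R s) (f : Matrix (Fin σ.size) (Fin σ.size) ℂ)
    (p : Fin σ.size) {q r : Fin σ.size} (h : R (box φ q) (box φ r)) :
    (f * σ.moveMatrix φ R) p q = f p r := by
  classical
  rw [Matrix.mul_apply, Finset.sum_eq_single r]
  · rw [moveMatrix_apply, if_pos h, mul_one]
  · intro z _ hz
    rw [moveMatrix_apply, if_neg, mul_zero]
    intro h'
    exact hz (box_injective φ (((hR.iff _ _).1 h').trans ((hR.iff _ _).1 h).symm))
  · simp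

theorem mul_moveMatrix_apply_eq_zero (f : Matrix (Fin σ.size) (Fin σ.size) ℂ)
    (p : Fin σ.size) {q : Fin σ.size} (h : ∀ r, ¬R (box φ q) (box φ r)) :
    (f * σ.moveMatrix φ R) p q = 0 := by
  classical
  rw [Matrix.mul_apply]
  exact Finset.sum_eq_zero fun z _ => by rw [moveMatrix_apply, if_neg (h z), mul_zero]

theorem moveMatrix_mul_apply (hR : IsShift R s) (f : Matrix (Fin σ.size) (Fin σ.size) ℂ)
    (q : Fin σ.size) {p r : Fin σ.size} (h : R (box φ r) (box φ p)) :
    (σ.moveMatrix φ R * f) p q = f r q := by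
  classical
  rw [Matrix.mul_apply, Finset.sum_eq_single r]
  · rw [moveMatrix_apply, if_pos h, one_mul]
  · intro z _ hz
    rw [moveMatrix_apply, if_neg, zero_mul]
    intro h'
    exact hz (box_injective φ (add_right_cancel
      (((hR.iff _ _).1 h').symm.trans ((hR.iff _ _).1 h))))
  · simp

theorem moveMatrix_mul_apply_eq_zero (f : Matrix (Fin σ.size) (Fin σ.size) ℂ)
    (q : Fin σ.size) {p : Fin σ.size} (h : ∀ r, ¬R (box φ r) (box φ p)) :
    (σ.moveMatrix φ R * f) p q = 0 := by
  classical
  rw [Matrix.mul_apply]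
  exact Finset.sum_eq_zero fun z _ => by rw [moveMatrix_apply, if_neg (h z), zero_mul]

theorem diag_entry_eq (hR : IsShift R s) {f : Matrix (Fin σ.size) (Fin σ.size) ℂ}
    (hf : f * σ.moveMatrix φ R = σ.moveMatrix φ R * f) {p q : Fin σ.size}
    (h : R (box φ p) (box φ q)) : f p p = f q q := by
  rw [← moveMatrix_mul_apply hR f p h, ← hf, mul_moveMatrix_apply hR f q h]

/-- Comparing one entry of `f * R` and `R * f` transports entries along the shift. Going forward a
missing box would make the entry of `f` zero, going backward that of `g`; hence the product is
followed. -/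
theorem exists_shift_forward (hR : IsShift R s) {f g : Matrix (Fin σ.size) (Fin σ.size) ℂ}
    (hf : f * σ.moveMatrix φ R = σ.moveMatrix φ R * f)
    (hg : g * σ.moveMatrix φ R = σ.moveMatrix φ R * g) {c c' d : Fin σ.size}
    (h : R (box φ c) (box φ c')) (hne : f c d * g d c ≠ 0) :
    ∃ d', R (box φ d) (box φ d') ∧ f c' d' * g d' c' ≠ 0 := by
  have h1 : (f * σ.moveMatrix φ R) c' d = f c d := by rw [hf, moveMatrix_mul_apply hR f d h]
  obtain ⟨d', hd'⟩ : ∃ d', R (box φ d) (box φ d') := by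
    by_contra! hc
    rw [mul_moveMatrix_apply_eq_zero f c' hc] at h1
    rw [← h1, zero_mul] at hne
    exact hne rfl
  refine ⟨d', hd', ?_⟩
  rw [mul_moveMatrix_apply hR f c' hd'] at h1
  have h2 : g d' c' = g d c := by
    rw [← mul_moveMatrix_apply hR g d' h, hg, moveMatrix_mul_apply hR g c hd']
  rwa [h1, h2]

theorem exists_shift_backward (hR : IsShift R s) {f g : Matrix (Fin σ.size) (Fin σ.size) ℂ}
    (hf : f * σ.moveMatrix φ R = σ.moveMatrix φ R * f)
    (hg : g * σ.moveMatrix φ R = σ.moveMatrix φ R * g) {c c' d' : Fin σ.size}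
    (h : R (box φ c) (box φ c')) (hne : f c' d' * g d' c' ≠ 0) :
    ∃ d, R (box φ d) (box φ d') ∧ f c d * g d c ≠ 0 := by
  have h1 : (σ.moveMatrix φ R * g) d' c = g d' c' := by rw [← hg, mul_moveMatrix_apply hR g d' h]
  obtain ⟨d, hd⟩ : ∃ d, R (box φ d) (box φ d') := by
    by_contra! hc
    rw [moveMatrix_mul_apply_eq_zero g c hc] at h1
    rw [← h1, mul_zero] at hne
    exact hne rfl
  refine ⟨d, hd, ?_⟩
  rw [moveMatrix_mul_apply hR g c hd] at h1
  have h2 : f c' d' = f c d := by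
    rw [← mul_moveMatrix_apply hR f c' hd, hf, moveMatrix_mul_apply hR f d h]
  rwa [h1, ← h2]

theorem label_induction (hσ : σ.Connected) {P : Fin σ.size → Prop}
    (h : ∀ p q, Arrow (box φ p) (box φ q) → (P p ↔ P q)) {p : Fin σ.size} (hp : P p)
    (q : Fin σ.size) : P q := by
  have := connected_induction hσ (P := fun c => P (φ c)) (c := φ.symm p)
    (fun c d hcd => h _ _ (by simpa [box] using hcd)) (by simpa using hp) (φ.symm q)
  simpa using this

variable (φ) in
/-- The matrices that commute with both members of the nilpotent pair. -/
noncomputable def pairCommutant : Subalgebra ℂ (Matrix (Fin σ.size) (Fin σ.size) ℂ) :=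
  Subalgebra.centralizer ℂ {σ.moveMatrix φ East, σ.moveMatrix φ South}

theorem mem_pairCommutant {f : Matrix (Fin σ.size) (Fin σ.size) ℂ} :
    f ∈ pairCommutant φ ↔ f * σ.moveMatrix φ East = σ.moveMatrix φ East * f ∧
      f * σ.moveMatrix φ South = σ.moveMatrix φ South * f := by
  simp [pairCommutant, Subalgebra.mem_centralizer_iff, eq_comm]

/-- The off-diagonal entries do not contribute to the diagonal of a product. -/
theorem entry_mul_entry_eq_zero (hσ : σ.Connected) {f g : Matrix (Fin σ.size) (Fin σ.size) ℂ}
    (hf : f ∈ pairCommutant φ) (hg : g ∈ pairCommutant φ) {c d : Fin σ.size} (hcd : c ≠ d) :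
    f c d * g d c = 0 := by
  by_contra hne
  obtain ⟨hf1, hf2⟩ := mem_pairCommutant.1 hf
  obtain ⟨hg1, hg2⟩ := mem_pairCommutant.1 hg
  set u : ℤ := ((box φ d).1 : ℤ) - (box φ c).1 with hu
  set v : ℤ := ((box φ d).2 : ℤ) - (box φ c).2 with hv
  have hshift : ∀ {R : ℕ × ℕ → ℕ × ℕ → Prop} {s : ℕ × ℕ}, IsShift R s →
      f * σ.moveMatrix φ R = σ.moveMatrix φ R * f → g * σ.moveMatrix φ R = σ.moveMatrix φ R * g →
      ∀ p q, R (box φ p) (box φ q) →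
      ((∃ p', f p p' * g p' p ≠ 0 ∧ ((box φ p').1 : ℤ) = (box φ p).1 + u ∧
        ((box φ p').2 : ℤ) = (box φ p).2 + v) ↔
      ∃ q', f q q' * g q' q ≠ 0 ∧ ((box φ q').1 : ℤ) = (box φ q).1 + u ∧
        ((box φ q').2 : ℤ) = (box φ q).2 + v) := by
    intro R s hR hf hg p q hpq
    have e := (hR.iff _ _).1 hpq
    constructor
    · rintro ⟨p', h1, h2, h3⟩
      obtain ⟨q', h4, h5⟩ := exists_shift_forward hR hf hg hpq h1
      have e' := (hR.iff _ _).1 h4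
      refine ⟨q', h5, ?_, ?_⟩ <;> rw [e, e'] <;> push_cast [Prod.fst_add, Prod.snd_add] <;> omega
    · rintro ⟨q', h1, h2, h3⟩
      obtain ⟨p', h4, h5⟩ := exists_shift_backward hR hf hg hpq h1
      have e' := (hR.iff _ _).1 h4
      rw [e, e'] at h2 h3
      push_cast [Prod.fst_add, Prod.snd_add] at h2 h3
      exact ⟨p', h5, by omega, by omega⟩
  -- By connectedness, one nonzero product with displacement `(u, v)` gives one at every box.
  have hall := label_induction (φ := φ) hσ (P := fun p => ∃ p', f p p' * g p' p ≠ 0 ∧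
      ((box φ p').1 : ℤ) = (box φ p).1 + u ∧ ((box φ p').2 : ℤ) = (box φ p).2 + v)
    (fun p q hpq => by
      rcases hpq with h | h
      · exact hshift isShift_east hf1 hg1 p q h
      · exact hshift isShift_south hf2 hg2 p q h)
    (p := c) ⟨d, hne, by omega, by omega⟩
  -- Translation by `(u, v)` raises this linear form by `u² + v²`, which is impossible at a maximum
  -- unless the displacement is zero.
  obtain ⟨p, -, hp⟩ := Finset.exists_max_image Finset.univ
    (fun p : Fin σ.size => u * (box φ p).1 + v * (box φ p).2) ⟨c, Finset.mem_univ c⟩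
  obtain ⟨p', -, h1, h2⟩ := hall p
  have h3 := hp p' (Finset.mem_univ _)
  rw [h1, h2] at h3
  have h4 : u * u + v * v ≤ 0 := by linarith
  have hu0 : u = 0 := by nlinarith [mul_self_nonneg u, mul_self_nonneg v]
  have hv0 : v = 0 := by nlinarith [mul_self_nonneg u, mul_self_nonneg v]
  exact hcd (box_injective φ (Prod.ext (by omega) (by omega)))

theorem mul_diag_entry (hσ : σ.Connected) {f g : Matrix (Fin σ.size) (Fin σ.size) ℂ}
    (hf : f ∈ pairCommutant φ) (hg : g ∈ pairCommutant φ) (c : Fin σ.size) :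
    (f * g) c c = f c c * g c c := by
  rw [Matrix.mul_apply, Finset.sum_eq_single c]
  · intro d _ hd
    exact entry_mul_entry_eq_zero hσ hf hg hd.symm
  · simp

theorem diag_entry_const (hσ : σ.Connected) {f : Matrix (Fin σ.size) (Fin σ.size) ℂ}
    (hf : f ∈ pairCommutant φ) (c d : Fin σ.size) : f d d = f c c := by
  obtain ⟨h1, h2⟩ := mem_pairCommutant.1 hf
  refine label_induction (φ := φ) hσ (P := fun p => f p p = f c c) (fun p q hpq => ?_)
    (p := c) rfl d
  rcases hpq with h | h
  · rw [diag_entry_eq isShift_east h1 h]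
  · rw [diag_entry_eq isShift_south h2 h]

/-- The diagonal entry at `c` is a character of the commutant. Since the diagonal is constant, an
idempotent killed by it has trace zero, so it is zero, and the criterion for units applies. -/
theorem isUnit_of_mem_pairCommutant (hσ : σ.Connected)
    {f : Matrix (Fin σ.size) (Fin σ.size) ℂ} (hf : f ∈ pairCommutant φ) {c : Fin σ.size}
    (hc : f c c ≠ 0) : IsUnit f := by
  let ε : pairCommutant φ →ₐ[ℂ] ℂ :=
    { toFun := fun f => f.1 c c
      map_one' := by simp
      map_mul' := fun f g => mul_diag_entry hσ f.2 g.2 c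
      map_zero' := rfl
      map_add' := fun f g => rfl
      commutes' := fun a => by simp [Matrix.algebraMap_matrix_apply] }
  have hε : ∀ e : pairCommutant φ, IsIdempotentElem e → ε e = 0 → e = 0 := by
    intro e he h0
    have h1 : IsIdempotentElem (Matrix.toLin' e.1) := by
      rw [IsIdempotentElem, Module.End.mul_eq_comp, ← Matrix.toLin'_mul]
      exact congrArg (fun x : pairCommutant φ => Matrix.toLin' x.1) he
    have h2 : LinearMap.trace ℂ _ (Matrix.toLin' e.1) = 0 := by
      rw [Matrix.trace_toLin'_eq]
      exact Finset.sum_eq_zero fun d _ => (diag_entry_const hσ e.2 c d).trans h0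
    have h3 := (LinearMap.IsIdempotentElem.trace_eq_zero_iff h1).1 h2
    exact Subtype.ext (by simpa using h3)
  have := isUnit_of_character_ne_zero ε hε (f := ⟨f, hf⟩) (IsIntegral.of_finite ℂ _) hc
  exact this.map (pairCommutant φ).val

end SkewDiagram

/-! ## Semisimple pairs associated with a distinguished nilpotent pair -/

namespace Module.End

variable {V : Type*} [AddCommGroup V] [Module ℂ V]

/-- Projections onto the generalized eigenspaces. -/
theorem exists_maxGenEigenspace_projections [FiniteDimensional ℂ V] (h : End ℂ V) :
    ∃ P : ℂ → End ℂ V, (∀ s v, P s v ∈ h.maxGenEigenspace s) ∧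
      (∀ s v, v ∈ h.maxGenEigenspace s → P s v = v) ∧
      (∀ s t v, v ∈ h.maxGenEigenspace s → s ≠ t → P t v = 0) ∧
      ∀ v, ∃ S : Finset ℂ, ∑ s ∈ S, P s v = v := by
  classical
  have hint : DirectSum.IsInternal h.maxGenEigenspace :=
    (DirectSum.isInternal_submodule_iff_iSupIndep_and_iSup_eq_top _).2
      ⟨h.independent_maxGenEigenspace, h.iSup_maxGenEigenspace_eq_top⟩
  let := hint.chooseDecomposition
  refine ⟨fun s =>
    { toFun := fun v => (DirectSum.decompose h.maxGenEigenspace v s : V)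
      map_add' := fun u v => by rw [DirectSum.decompose_add]; rfl
      map_smul' := fun c v => by rw [DirectSum.decompose_smul]; rfl },
    fun s v => Subtype.property _, fun s v hv => DirectSum.decompose_of_mem_same _ hv,
    fun s t v hv hst => DirectSum.decompose_of_mem_ne _ hv hst,
    fun v => ⟨_, DirectSum.sum_support_decompose h.maxGenEigenspace v⟩⟩

theorem map_mem_maxGenEigenspace_of_semiconj {W : Type*} [AddCommGroup W] [Module ℂ W]
    {h : End ℂ V} {k : End ℂ W} {d : V →ₗ[ℂ] W} {s t : ℂ}
    (hd : ∀ v, d (h v - s • v) = k (d v) - t • d v) {v : V} (hv : v ∈ h.maxGenEigenspace s) :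
    d v ∈ k.maxGenEigenspace t := by
  rw [mem_maxGenEigenspace] at hv ⊢
  obtain ⟨m, hm⟩ := hv
  refine ⟨m, ?_⟩
  have key : ∀ (m : ℕ) (v : V), d (((h - s • 1 : End ℂ V) ^ m) v) =
      ((k - t • 1 : End ℂ W) ^ m) (d v) := by
    intro m
    induction m with
    | zero => simp
    | succ m ih =>
      intro v
      rw [pow_succ, pow_succ, mul_apply, mul_apply, ih]
      congr 1
      simpa using hd v
  rw [← key, hm, map_zero]

/-- The projections onto generalized eigenspaces are permuted by an operator that raises
eigenvalues. -/
theorem projection_comm_of_raise [FiniteDimensional ℂ V] {h d : End ℂ V} {b : ℂ}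
    (hd : h * d - d * h = b • d) {P : ℂ → End ℂ V}
    (hP : ∀ s v, v ∈ h.maxGenEigenspace s → P s v = v)
    (hP' : ∀ s t v, v ∈ h.maxGenEigenspace s → s ≠ t → P t v = 0) (s : ℂ) (v : V) :
    P (s + b) (d v) = d (P s v) := by
  have hv : v ∈ ⨆ t, h.maxGenEigenspace t := by
    rw [h.iSup_maxGenEigenspace_eq_top]
    trivial
  induction hv using Submodule.iSup_induction' with
  | mem t v hv =>
    have hdv : d v ∈ h.maxGenEigenspace (t + b) := by
      refine map_mem_maxGenEigenspace_of_semiconj (h := h) (s := t) (fun v => ?_) hv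
      have := LinearMap.congr_fun hd v
      simp only [LinearMap.sub_apply, mul_apply, LinearMap.smul_apply] at this
      rw [map_sub, map_smul, add_smul, ← this]
      abel
    by_cases hst : t = s
    · subst hst
      rw [hP _ _ hv, hP _ _ hdv]
    · rw [hP' _ _ _ hv hst, hP' _ _ _ hdv fun e => hst (add_right_cancel e), map_zero]
  | zero => simp
  | add u v _ _ hu hv => rw [map_add, map_add, map_add, map_add, hu, hv]

end Module.End

/-- A matrix for which every basis vector is a generalized eigenvector, with distinct eigenvalues,
is diagonal. -/
theorem Matrix.eq_diagonal_of_mem_maxGenEigenspace {ι : Type*} [Fintype ι] [DecidableEq ι]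
    {K : Matrix ι ι ℂ} {κ : ι → ℂ} (hκ : Function.Injective κ)
    (hK : ∀ c, Pi.single c 1 ∈ Module.End.maxGenEigenspace (Matrix.toLin' K) (κ c)) :
    K = Matrix.diagonal κ := by
  set k : Module.End ℂ (ι → ℂ) := Matrix.toLin' K with hk
  -- The other coordinates of `u` lie in the other generalized eigenspaces, which are independent of
  -- this one; so each of them is a coordinate line.
  have hline : ∀ c (u : ι → ℂ), u ∈ k.maxGenEigenspace (κ c) → u = u c • Pi.single c 1 := by
    intro c u hu
    have h1 : u - u c • Pi.single c 1 ∈ k.maxGenEigenspace (κ c) :=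
      Submodule.sub_mem _ hu (Submodule.smul_mem _ _ (hK c))
    have h2 : u - u c • Pi.single c 1 ∈ ⨆ t, ⨆ (_ : t ≠ κ c), k.maxGenEigenspace t := by
      have e : u - u c • Pi.single c 1 =
          ∑ d ∈ Finset.univ.erase c, u d • (Pi.single d 1 : ι → ℂ) := by
        rw [sub_eq_iff_eq_add, Finset.sum_erase_add _ _ (Finset.mem_univ c)]
        exact pi_eq_sum_univ' u
      rw [e]
      refine Submodule.sum_mem _ fun d hd => Submodule.smul_mem _ _ ?_
      exact Submodule.mem_iSup_of_mem (κ d) (Submodule.mem_iSup_of_mem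
        (fun e => (Finset.mem_erase.1 hd).1 (hκ e)) (hK d))
    have h3 := Submodule.disjoint_def.1 (k.independent_maxGenEigenspace (κ c)) _ h1 h2
    exact sub_eq_zero.1 h3
  ext p c
  have hmem : k (Pi.single c 1) ∈ k.maxGenEigenspace (κ c) :=
    Module.End.mapsTo_maxGenEigenspace_of_comm (Commute.refl k) _ (hK c)
  have hcol := hline c _ hmem
  set a := k (Pi.single c 1) c with ha
  -- On this line `k - κ c` is the scalar `a - κ c`, and it is nilpotent.
  have haκ : a = κ c := by
    obtain ⟨m, hm⟩ := (Module.End.mem_maxGenEigenspace _ _ _).1 (hK c)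
    have hpow : ∀ m : ℕ, ((k - κ c • 1 : Module.End ℂ (ι → ℂ)) ^ m) (Pi.single c 1) = (a - κ c) ^ m • Pi.single c 1 := by
      intro m
      induction m with
      | zero => simp
      | succ m ih =>
        rw [pow_succ', Module.End.mul_apply, ih, map_smul, LinearMap.sub_apply, hcol]
        simp only [LinearMap.smul_apply, Module.End.one_apply]
        rw [← sub_smul, smul_smul, pow_succ]
    rw [hpow] at hm
    have := congrFun hm c
    simp only [Pi.smul_apply, Pi.single_eq_same, smul_eq_mul, mul_one, Pi.zero_apply] at this
    exact sub_eq_zero.1 (by_contra fun h => pow_ne_zero m h this)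
  have hKc : k (Pi.single c 1) p = K p c := by
    rw [hk, Matrix.toLin'_apply, Matrix.mulVec_single_one]
    rfl
  rw [← hKc, hcol, haκ, Matrix.diagonal_apply]
  by_cases hpc : p = c
  · subst hpc
    simp
  · simp [hpc]

theorem Matrix.eq_diagonal_of_comm {ι : Type*} [Fintype ι] [DecidableEq ι] {K : Matrix ι ι ℂ}
    {κ : ι → ℂ} (hκ : Function.Injective κ)
    (hK : K * Matrix.diagonal κ = Matrix.diagonal κ * K) : ∃ η, K = Matrix.diagonal η := by
  refine ⟨fun c => K c c, ?_⟩
  ext p q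
  by_cases hpq : p = q
  · subst hpq
    rw [Matrix.diagonal_apply_eq]
  · rw [Matrix.diagonal_apply_ne _ hpq]
    have := congrFun (congrFun hK p) q
    rw [Matrix.mul_diagonal, Matrix.diagonal_mul] at this
    have h1 : (κ q - κ p) * K p q = 0 := by linear_combination this
    exact (mul_eq_zero.1 h1).resolve_left (sub_ne_zero.2 fun e => hpq (hκ e.symm))

/-! ### Diagonalizing the semisimple pair inside the commutant -/

namespace SkewDiagram

variable {σ : SkewDiagram} {φ : σ.cells ≃ Fin σ.size}

/-- The complex number that records the position of a box. -/
noncomputable def boxValue (c : ℕ × ℕ) : ℂ := c.2 + Complex.I * c.1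

theorem boxValue_injective : Function.Injective boxValue := by
  intro c d h
  have h1 := congrArg Complex.re h
  have h2 := congrArg Complex.im h
  simp [boxValue] at h1 h2
  exact Prod.ext h2 h1

theorem boxValue_of_east {c d : ℕ × ℕ} (h : East c d) : boxValue d = boxValue c + 1 := by
  rw [h]
  simp only [boxValue]
  push_cast
  ring

theorem boxValue_of_south {c d : ℕ × ℕ} (h : South c d) : boxValue d = boxValue c + Complex.I := by
  rw [h]
  simp only [boxValue]
  push_cast
  ring

theorem moveMatrix_mulVec_single {R : ℕ × ℕ → ℕ × ℕ → Prop} {s : ℕ × ℕ} (hR : IsShift R s)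
    {p q : Fin σ.size} (h : R (box φ p) (box φ q)) :
    Matrix.toLin' (σ.moveMatrix φ R) (Pi.single p 1) = Pi.single q 1 := by
  ext r
  rw [Matrix.toLin'_apply, Matrix.mulVec_single_one]
  have := mul_moveMatrix_apply hR (1 : Matrix (Fin σ.size) (Fin σ.size) ℂ) r h
  rw [one_mul] at this
  change σ.moveMatrix φ R r p = _
  rw [this, Matrix.one_apply, Pi.single_apply]

theorem moveMatrix_mulVec_single_eq_zero {R : ℕ × ℕ → ℕ × ℕ → Prop}
    {p : Fin σ.size} (h : ∀ q, ¬R (box φ p) (box φ q)) :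
    Matrix.toLin' (σ.moveMatrix φ R) (Pi.single p 1) = 0 := by
  ext r
  rw [Matrix.toLin'_apply, Matrix.mulVec_single_one]
  have := mul_moveMatrix_apply_eq_zero (1 : Matrix (Fin σ.size) (Fin σ.size) ℂ) r h
  rw [one_mul] at this
  exact this

/-- An operator that has the commutation relations of the grading operator `column + i * row` is
conjugate to it, up to a shift, by an element of the commutant of the nilpotent pair. -/
theorem exists_conj_eq_diagonal (hσ : σ.Connected) {H : Matrix (Fin σ.size) (Fin σ.size) ℂ}
    (h1 : H * σ.moveMatrix φ East - σ.moveMatrix φ East * H = σ.moveMatrix φ East)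
    (h2 : H * σ.moveMatrix φ South - σ.moveMatrix φ South * H =
      Complex.I • σ.moveMatrix φ South) :
    ∃ (G : GL (Fin σ.size) ℂ) (κ : Fin σ.size → ℂ), Function.Injective κ ∧
      G.1 ∈ pairCommutant φ ∧ G⁻¹.1 * H * G.1 = Matrix.diagonal κ := by
  obtain ⟨P, hPmem, hP, hP', hPsum⟩ :=
    Module.End.exists_maxGenEigenspace_projections (Matrix.toLin' H)
  obtain ⟨c₀⟩ : Nonempty (Fin σ.size) := hσ.nonempty.map φ
  -- The projections of a basis vector add up to it, so some projection keeps its own coordinate.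
  obtain ⟨t, ht⟩ : ∃ t, P t (Pi.single c₀ 1) c₀ ≠ 0 := by
    obtain ⟨S, hS⟩ := hPsum (Pi.single c₀ 1)
    by_contra! hc
    have := congrFun hS c₀
    rw [Finset.sum_apply, Finset.sum_eq_zero fun s _ => hc s, Pi.single_eq_same] at this
    exact zero_ne_one this
  set τ := t - boxValue (box φ c₀) with hτ
  -- Each basis vector is projected to the generalized eigenspace for its box value, shifted by `τ`
  -- so that `c₀` gets the eigenvalue `t`. The commutation relations of `H` put `g` in the
  -- commutant, and the choice of `t` makes it invertible.
  let g : Matrix (Fin σ.size) (Fin σ.size) ℂ :=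
    Matrix.of fun x c => P (boxValue (box φ c) + τ) (Pi.single c 1) x
  have hgcol : ∀ c, Matrix.toLin' g (Pi.single c 1) =
      P (boxValue (box φ c) + τ) (Pi.single c 1) := by
    intro c
    rw [Matrix.toLin'_apply, Matrix.mulVec_single_one]
    rfl
  have hcomm : ∀ {R : ℕ × ℕ → ℕ × ℕ → Prop} {s : ℕ × ℕ} {b : ℂ}, IsShift R s →
      (∀ c d, R c d → boxValue d = boxValue c + b) →
      H * σ.moveMatrix φ R - σ.moveMatrix φ R * H = b • σ.moveMatrix φ R →
      g * σ.moveMatrix φ R = σ.moveMatrix φ R * g := by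
    intro R s b hR hb hH
    have hH' : Matrix.toLin' H * Matrix.toLin' (σ.moveMatrix φ R) -
        Matrix.toLin' (σ.moveMatrix φ R) * Matrix.toLin' H =
        b • Matrix.toLin' (σ.moveMatrix φ R) := by
      have := congrArg Matrix.toLin' hH
      rwa [map_sub, Matrix.toLin'_mul, Matrix.toLin'_mul, map_smul] at this
    have hraise := Module.End.projection_comm_of_raise hH' hP hP'
    apply Matrix.toLin'.injective
    refine (Pi.basisFun ℂ _).ext fun p => ?_
    rw [Pi.basisFun_apply, Matrix.toLin'_mul, Matrix.toLin'_mul, LinearMap.comp_apply,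
      LinearMap.comp_apply, hgcol, ← hraise]
    by_cases hp : ∃ q, R (box φ p) (box φ q)
    · obtain ⟨q, hq⟩ := hp
      rw [moveMatrix_mulVec_single hR hq, hgcol, hb _ _ hq]
      congr 2
      ring
    · push Not at hp
      rw [moveMatrix_mulVec_single_eq_zero hp, map_zero, map_zero]
  have hg : g ∈ pairCommutant φ := mem_pairCommutant.2
    ⟨hcomm isShift_east (fun _ _ => boxValue_of_east) (by rw [h1, one_smul]),
      hcomm isShift_south (fun _ _ => boxValue_of_south) h2⟩
  have hgc : g c₀ c₀ ≠ 0 := by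
    change P (boxValue (box φ c₀) + τ) (Pi.single c₀ 1) c₀ ≠ 0
    rwa [hτ, add_sub_cancel]
  obtain ⟨G, hG⟩ := isUnit_of_mem_pairCommutant hσ hg hgc
  have hκ : Function.Injective fun c => boxValue (box φ c) + τ := fun c d h =>
    box_injective φ (boxValue_injective (add_right_cancel h))
  refine ⟨G, _, hκ, hG.symm ▸ hg, Matrix.eq_diagonal_of_mem_maxGenEigenspace hκ fun c => ?_⟩
  have hinv : Matrix.toLin' G⁻¹.1 (Matrix.toLin' g (Pi.single c 1)) = Pi.single c 1 := by
    rw [← LinearMap.comp_apply, ← Matrix.toLin'_mul, ← hG, Units.inv_mul, Matrix.toLin'_one]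
    rfl
  rw [← hinv]
  refine Module.End.map_mem_maxGenEigenspace_of_semiconj (h := Matrix.toLin' H)
    (s := boxValue (box φ c) + τ) (fun v => ?_) (hgcol c ▸ hPmem _ _)
  rw [map_sub, map_smul]
  congr 1
  simp only [← LinearMap.comp_apply, ← Matrix.toLin'_mul]
  rw [mul_assoc, Units.mul_inv, mul_one]

/-- Simultaneous normal form of a distinguished nilpotent pair and an associated semisimple
pair. -/
theorem exists_normal_form (hσ : σ.Connected) {e h : σ.sl × σ.sl} (he : σ.IsAttached e)
    (hh : IsAssociatedSemisimplePair e h) :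
    ∃ (φ : σ.cells ≃ Fin σ.size) (G : GL (Fin σ.size) ℂ) (η₁ η₂ : Fin σ.size → ℂ),
      G⁻¹.1 * e.1.1 * G.1 = σ.moveMatrix φ East ∧ G⁻¹.1 * e.2.1 * G.1 = σ.moveMatrix φ South ∧
      G⁻¹.1 * h.1.1 * G.1 = Matrix.diagonal η₁ ∧ G⁻¹.1 * h.2.1 * G.1 = Matrix.diagonal η₂ ∧
      Function.Injective fun c => η₁ c + Complex.I * η₂ c := by
  obtain ⟨φ, g, he1, he2⟩ := he
  have bracket : ∀ {x y z : σ.sl}, ⁅x, y⁆ = z → x.1 * y.1 - y.1 * x.1 = z.1 := by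
    rintro x y z rfl
    rfl
  have conj_mul : ∀ (G : GL (Fin σ.size) ℂ) (x y : Matrix (Fin σ.size) (Fin σ.size) ℂ),
      G⁻¹.1 * (x * y) * G.1 = (G⁻¹.1 * x * G.1) * (G⁻¹.1 * y * G.1) := fun G x y => by
    simp only [mul_assoc, Units.mul_inv_cancel_left]
  have conj_bracket : ∀ (G : GL (Fin σ.size) ℂ) {x y z : Matrix (Fin σ.size) (Fin σ.size) ℂ},
      x * y - y * x = z → (G⁻¹.1 * x * G.1) * (G⁻¹.1 * y * G.1) -
        (G⁻¹.1 * y * G.1) * (G⁻¹.1 * x * G.1) = G⁻¹.1 * z * G.1 := by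
    rintro G x y z rfl
    rw [← conj_mul, ← conj_mul, mul_sub, sub_mul]
  have e1 : g⁻¹.1 * e.1.1 * g.1 = σ.moveMatrix φ East := by
    rw [he1]
    simp [mul_assoc]
  have e2 : g⁻¹.1 * e.2.1 * g.1 = σ.moveMatrix φ South := by
    rw [he2]
    simp [mul_assoc]
  set A₁ := g⁻¹.1 * h.1.1 * g.1 with hA₁
  set A₂ := g⁻¹.1 * h.2.1 * g.1 with hA₂
  have b11 := conj_bracket g (bracket hh.lie₁₁)
  have b12 := conj_bracket g (bracket hh.lie₁₂)
  have b21 := conj_bracket g (bracket hh.lie₂₁)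
  have b22 := conj_bracket g (bracket hh.lie₂₂)
  have bc := conj_bracket g (bracket hh.comm)
  rw [← hA₁, e1] at b11
  rw [← hA₁, e2] at b12
  rw [← hA₂, e1] at b21
  rw [← hA₂, e2] at b22
  rw [← hA₁, ← hA₂] at bc
  simp only [ZeroMemClass.coe_zero, mul_zero, zero_mul] at b12 b21 bc
  -- The combination with `Complex.I` lets a single operator separate both rows and columns.
  obtain ⟨G, κ, hκ, hG, hdiag⟩ := exists_conj_eq_diagonal (φ := φ) hσ
    (H := A₁ + Complex.I • A₂)
    (by
      rw [add_mul, mul_add, smul_mul_assoc, mul_smul_comm, add_sub_add_comm, ← smul_sub, b11, b21,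
        smul_zero, add_zero])
    (by
      rw [add_mul, mul_add, smul_mul_assoc, mul_smul_comm, add_sub_add_comm, ← smul_sub, b12, b22,
        zero_add])
  obtain ⟨hG1, hG2⟩ := mem_pairCommutant.1 hG
  have hsum : G⁻¹.1 * A₁ * G.1 + Complex.I • (G⁻¹.1 * A₂ * G.1) = Matrix.diagonal κ := by
    rw [← hdiag, mul_add, add_mul, mul_smul_comm, smul_mul_assoc]
  have hc := conj_bracket G bc
  rw [mul_zero, zero_mul, sub_eq_zero] at hc
  -- Both conjugates commute with their combination, a diagonal matrix with distinct entries, so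
  -- each is diagonal.
  obtain ⟨η₁, hη₁⟩ := Matrix.eq_diagonal_of_comm hκ (K := G⁻¹.1 * A₁ * G.1) (by
    rw [← hsum, mul_add, add_mul, mul_smul_comm, smul_mul_assoc, hc])
  obtain ⟨η₂, hη₂⟩ := Matrix.eq_diagonal_of_comm hκ (K := G⁻¹.1 * A₂ * G.1) (by
    rw [← hsum, mul_add, add_mul, mul_smul_comm, smul_mul_assoc, hc])
  have assoc : ∀ x : Matrix (Fin σ.size) (Fin σ.size) ℂ,
      (g * G)⁻¹.1 * x * (g * G).1 = G⁻¹.1 * (g⁻¹.1 * x * g.1) * G.1 := fun x => by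
    rw [mul_inv_rev, Units.val_mul, Units.val_mul]
    simp only [mul_assoc]
  refine ⟨φ, g * G, η₁, η₂, ?_, ?_, ?_, ?_, ?_⟩
  · rw [assoc, e1, mul_assoc, ← hG1, Units.inv_mul_cancel_left]
  · rw [assoc, e2, mul_assoc, ← hG2, Units.inv_mul_cancel_left]
  · rw [assoc, ← hA₁, hη₁]
  · rw [assoc, ← hA₂, hη₂]
  · rw [hη₁, hη₂, ← Matrix.diagonal_smul, Matrix.diagonal_add] at hsum
    have := Matrix.diagonal_injective hsum
    rw [← this] at hκ
    exact hκ

end SkewDiagram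

/-! ## Solvable Lie algebras of matrices -/

section Triangular

variable {ι : Type*} [Fintype ι] {L : Type*} [LieRing L] [LieAlgebra ℂ L]

/-- Lie's theorem for matrix representations. -/
theorem exists_common_eigenvector [LieAlgebra.IsSolvable L] [Nonempty ι]
    (ρ : L →ₗ[ℂ] Matrix ι ι ℂ) (hρ : ∀ x y, ρ ⁅x, y⁆ = ρ x * ρ y - ρ y * ρ x) :
    ∃ v : ι → ℂ, v ≠ 0 ∧ ∀ x, ∃ c : ℂ, Matrix.mulVec (ρ x) v = c • v := by
  let _ : LieRingModule L (ι → ℂ) :=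
    { bracket := fun x v => Matrix.mulVec (ρ x) v
      add_lie := fun x y v => by
        change Matrix.mulVec (ρ (x + y)) v = Matrix.mulVec (ρ x) v + Matrix.mulVec (ρ y) v
        rw [map_add, Matrix.add_mulVec]
      lie_add := fun x v w => Matrix.mulVec_add _ _ _
      leibniz_lie := fun x y v => by
        change Matrix.mulVec (ρ x) (Matrix.mulVec (ρ y) v) = Matrix.mulVec (ρ ⁅x, y⁆) v +
          Matrix.mulVec (ρ y) (Matrix.mulVec (ρ x) v)
        rw [hρ, Matrix.sub_mulVec, Matrix.mulVec_mulVec, Matrix.mulVec_mulVec, sub_add_cancel] }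
  have _ : LieModule ℂ L (ι → ℂ) :=
    { smul_lie := fun c x v => by
        change Matrix.mulVec (ρ (c • x)) v = c • Matrix.mulVec (ρ x) v
        rw [map_smul, Matrix.smul_mulVec]
      lie_smul := fun c x v => Matrix.mulVec_smul _ _ _ }
  obtain ⟨χ, hχ⟩ := LieModule.exists_nontrivial_weightSpace_of_isSolvable ℂ L (ι → ℂ)
  obtain ⟨⟨v, hv⟩, hne⟩ := exists_ne (0 : LieModule.weightSpace (ι → ℂ) χ)
  rw [LieModule.mem_weightSpace] at hv
  exact ⟨v, fun h => hne (Subtype.ext h), fun x => ⟨χ x, hv x⟩⟩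

variable [DecidableEq ι]

/-- In a solvable Lie algebra of matrices that contains a diagonal matrix with distinct entries,
an invariant coordinate subspace can be enlarged by one coordinate. -/
theorem exists_enlarge_stable [LieAlgebra.IsSolvable L] (ρ : L →ₗ[ℂ] Matrix ι ι ℂ)
    (hρ : ∀ x y, ρ ⁅x, y⁆ = ρ x * ρ y - ρ y * ρ x) {h : L} {η : ι → ℂ}
    (hη : Function.Injective η) (hh : ρ h = Matrix.diagonal η) {X : Finset ι}
    (hX : ∀ x, ∀ p ∉ X, ∀ q ∈ X, ρ x p q = 0) (hne : X ≠ Finset.univ) :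
    ∃ q ∉ X, ∀ x, ∀ p ∉ X, p ≠ q → ρ x p q = 0 := by
  obtain ⟨p₀, hp₀⟩ : ∃ p, p ∉ X := by
    by_contra! hc
    exact hne (Finset.eq_univ_iff_forall.2 hc)
  -- The submatrices on the complement of `X` describe the action on the quotient by the invariant
  -- coordinate subspace, where Lie's theorem is applied.
  let κ := {p // p ∉ X}
  have : Nonempty κ := ⟨⟨p₀, hp₀⟩⟩
  let ρ' : L →ₗ[ℂ] Matrix κ κ ℂ :=
    { toFun := fun x => (ρ x).submatrix Subtype.val Subtype.val
      map_add' := fun x y => by rw [map_add]; rfl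
      map_smul' := fun c x => by rw [map_smul]; rfl }
  have hmul : ∀ x y (p q : κ), (ρ x * ρ y) p.1 q.1 = (ρ' x * ρ' y) p q := by
    intro x y p q
    rw [Matrix.mul_apply, Matrix.mul_apply]
    have h0 : ∑ r ∈ X, ρ x p.1 r * ρ y r q.1 = 0 :=
      Finset.sum_eq_zero fun r hr => by rw [hX x p.1 p.2 r hr, zero_mul]
    rw [← Finset.sum_add_sum_compl X, h0, zero_add]
    exact Finset.sum_subtype _ (fun r => by simp) _
  have hρ' : ∀ x y, ρ' ⁅x, y⁆ = ρ' x * ρ' y - ρ' y * ρ' x := by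
    intro x y
    ext p q
    rw [Matrix.sub_apply, ← hmul, ← hmul, ← Matrix.sub_apply, ← hρ]
    rfl
  obtain ⟨v, hv0, hv⟩ := exists_common_eigenvector ρ' hρ'
  obtain ⟨q, hq⟩ : ∃ q, v q ≠ 0 := by
    by_contra! hc
    exact hv0 (funext hc)
  obtain ⟨c, hc⟩ := hv h
  have hdiag : ∀ p : κ, (η p.1 - c) * v p = 0 := by
    intro p
    have h1 := congrFun hc p
    have h2 : ρ' h = Matrix.diagonal fun p : κ => η p.1 := by
      ext p q
      change ρ h p.1 q.1 = _
      rw [hh]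
      by_cases hpq : p = q
      · rw [hpq, Matrix.diagonal_apply_eq, Matrix.diagonal_apply_eq]
      · rw [Matrix.diagonal_apply_ne _ hpq,
          Matrix.diagonal_apply_ne _ fun e => hpq (Subtype.ext e)]
    rw [h2, Matrix.mulVec_diagonal, Pi.smul_apply, smul_eq_mul] at h1
    linear_combination h1
  -- An eigenvector of a diagonal matrix with distinct entries is supported on one coordinate.
  have hcq : η q.1 = c := sub_eq_zero.1 ((mul_eq_zero.1 (hdiag q)).resolve_right hq)
  have hsupp : ∀ p, p ≠ q → v p = 0 := fun p hp =>
    (mul_eq_zero.1 (hdiag p)).resolve_left (sub_ne_zero.2 fun e =>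
      hp (Subtype.ext (hη (e.trans hcq.symm))))
  refine ⟨q.1, q.2, fun x p hp hpq => ?_⟩
  obtain ⟨d, hd⟩ := hv x
  have h1 := congrFun hd ⟨p, hp⟩
  have hne : (⟨p, hp⟩ : κ) ≠ q := fun e => hpq (congrArg Subtype.val e)
  rw [Pi.smul_apply, hsupp _ hne, smul_zero, Matrix.mulVec, dotProduct,
    Finset.sum_eq_single q (fun r _ hr => by rw [hsupp r hr, mul_zero]) (by simp)] at h1
  exact (mul_eq_zero.1 h1).resolve_right hq

/-- A solvable Lie algebra of matrices that contains a diagonal matrix with distinct entries is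
triangular with respect to some order of the coordinates. -/
theorem exists_triangular_order [LieAlgebra.IsSolvable L] (ρ : L →ₗ[ℂ] Matrix ι ι ℂ)
    (hρ : ∀ x y, ρ ⁅x, y⁆ = ρ x * ρ y - ρ y * ρ x) {h : L} {η : ι → ℂ}
    (hη : Function.Injective η) (hh : ρ h = Matrix.diagonal η) {n : ℕ} (hn : Fintype.card ι = n) :
    ∃ r : ι ≃ Fin n, ∀ x p q, r p < r q → ρ x p q = 0 := by
  -- Ranks are assigned from `n - 1` downward: the `k` coordinates in `X` have the top ranks and
  -- span an invariant subspace.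
  have key : ∀ k ≤ n, ∃ (X : Finset ι) (r : ι → ℕ), X.card = k ∧ Set.InjOn r X ∧
      (∀ p ∈ X, n ≤ r p + k ∧ r p < n) ∧
      ∀ x p, ∀ q ∈ X, (p ∉ X ∨ r p < r q) → ρ x p q = 0 := by
    intro k
    induction k with
    | zero => exact fun _ => ⟨∅, fun _ => 0, by simp⟩
    | succ k ih =>
      intro hk
      obtain ⟨X, r, hcard, hinj, hrange, htri⟩ := ih (by omega)
      obtain ⟨q, hq, hstab⟩ := exists_enlarge_stable ρ hρ hη hh (X := X)
        (fun x p hp q hq => htri x p q hq (Or.inl hp)) (by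
          rintro rfl
          rw [Finset.card_univ] at hcard
          omega)
      have hold : ∀ p ∈ X, Function.update r q (n - k - 1) p = r p := fun p hp =>
        Function.update_of_ne (fun e => hq (by rwa [← e])) _ _
      have hnew : Function.update r q (n - k - 1) q = n - k - 1 := Function.update_self _ _ _
      refine ⟨insert q X, Function.update r q (n - k - 1), by
        rw [Finset.card_insert_of_notMem hq, hcard], ?_, ?_, ?_⟩
      · intro a ha b hb hab
        rw [Finset.mem_coe, Finset.mem_insert] at ha hb
        rcases ha with rfl | ha <;> rcases hb with rfl | hb
        · rfl
        · rw [hnew, hold b hb] at hab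
          have := hrange b hb
          omega
        · rw [hnew, hold a ha] at hab
          have := hrange a ha
          omega
        · rw [hold a ha, hold b hb] at hab
          exact hinj ha hb hab
      · intro p hp
        rcases Finset.mem_insert.1 hp with rfl | hp
        · rw [hnew]
          omega
        · rw [hold p hp]
          have := hrange p hp
          omega
      · intro x p q' hq' hlt
        rcases Finset.mem_insert.1 hq' with rfl | hq'
        · rcases hlt with hlt | hlt
          · rw [Finset.mem_insert, not_or] at hlt
            exact hstab x p hlt.2 hlt.1
          · by_cases hp : p ∈ X
            · rw [hnew, hold p hp] at hlt
              have := hrange p hp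
              omega
            · exact hstab x p hp fun e => by
                rw [e] at hlt
                exact lt_irrefl _ hlt
        · by_cases hp : p ∈ X
          · refine htri x p q' hq' (hlt.imp (fun h => absurd (Finset.mem_insert_of_mem hp) h) ?_)
            rw [hold p hp, hold q' hq']
            exact id
          · exact htri x p q' hq' (Or.inl hp)
  obtain ⟨X, r, hcard, hinj, hrange, htri⟩ := key n le_rfl
  have hX : X = Finset.univ := Finset.eq_univ_of_card X (hcard.trans hn.symm)
  subst hX
  let f : ι → Fin n := fun p => ⟨r p, (hrange p (Finset.mem_univ p)).2⟩
  have hf : Function.Bijective f := by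
    rw [Fintype.bijective_iff_injective_and_card, Fintype.card_fin]
    exact ⟨fun a b hab => hinj (by simp) (by simp) (congrArg Fin.val hab), hn⟩
  exact ⟨Equiv.ofBijective f hf, fun x p q hlt => htri x p q (Finset.mem_univ q) (Or.inr hlt)⟩

/-- A Lie algebra with a descending chain of subspaces in which brackets move down is solvable. -/
theorem LieAlgebra.isSolvable_of_chain (N : ℕ → Submodule ℂ L) (h0 : N 0 = ⊤) {m : ℕ}
    (hm : N m = ⊥) (hN : ∀ k, ∀ x ∈ N k, ∀ y ∈ N k, ⁅x, y⁆ ∈ N (k + 1)) :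
    LieAlgebra.IsSolvable L := by
  have key : ∀ k, (LieAlgebra.derivedSeries ℂ L k).toSubmodule ≤ N k := by
    intro k
    induction k with
    | zero =>
      rw [h0]
      exact le_top
    | succ k ih =>
      rw [LieAlgebra.derivedSeries_def, LieAlgebra.derivedSeriesOfIdeal_succ,
        LieSubmodule.lieIdeal_oper_eq_linear_span]
      refine Submodule.span_le.2 ?_
      rintro _ ⟨x, y, rfl⟩
      exact hN k _ (ih x.2) _ (ih y.2)
  refine LieAlgebra.IsSolvable.mk (R := ℂ) (k := m) ?_
  rw [← LieSubmodule.toSubmodule_eq_bot, eq_bot_iff, ← hm]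
  exact key m

end Triangular

/-! ## Borel subalgebras of `sl(n)` as stabilizers of ordered bases -/

section Flags

variable {ι : Type*} [Fintype ι] [DecidableEq ι]

open LieAlgebra.SpecialLinear

/-- The matrix of an element of `sl(n)` in the basis of the columns of `G`. -/
noncomputable def conjMatrix (G : GL ι ℂ) : sl ι ℂ →ₗ[ℂ] Matrix ι ι ℂ where
  toFun y := G⁻¹.1 * y.1 * G.1
  map_add' x y := by
    change G⁻¹.1 * (x.1 + y.1) * G.1 = _
    rw [mul_add, add_mul]
  map_smul' c x := by
    change G⁻¹.1 * (c • x.1) * G.1 = c • (G⁻¹.1 * x.1 * G.1)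
    rw [mul_smul_comm, smul_mul_assoc]

theorem conjMatrix_apply (G : GL ι ℂ) (y : sl ι ℂ) : conjMatrix G y = G⁻¹.1 * y.1 * G.1 := rfl

theorem conjMatrix_lie (G : GL ι ℂ) (x y : sl ι ℂ) :
    conjMatrix G ⁅x, y⁆ = conjMatrix G x * conjMatrix G y - conjMatrix G y * conjMatrix G x := by
  simp only [conjMatrix_apply, sl_bracket, mul_sub, sub_mul, mul_assoc, Units.mul_inv_cancel_left]

theorem conjMatrix_injective (G : GL ι ℂ) : Function.Injective (conjMatrix G) := by
  intro x y h
  have := congrArg (fun z => G.1 * z * G⁻¹.1) h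
  simp only [conjMatrix_apply, mul_assoc, Units.mul_inv_cancel_left, Units.mul_inv, mul_one] at this
  exact Subtype.ext this

theorem exists_conjMatrix_eq_single (G : GL ι ℂ) {p q : ι} (hpq : p ≠ q) :
    ∃ y, conjMatrix G y = Matrix.single p q 1 := by
  refine ⟨⟨G.1 * Matrix.single p q 1 * G⁻¹.1, ?_⟩, ?_⟩
  · change Matrix.trace (G.1 * Matrix.single p q 1 * G⁻¹.1) = 0
    rw [Matrix.trace_mul_comm, Units.inv_mul_cancel_left, Matrix.trace_single_eq_of_ne _ _ _ hpq]
  · simp only [conjMatrix_apply, mul_assoc, Units.inv_mul_cancel_left, Units.inv_mul, mul_one]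

/-- The stabilizer of the flag that is spanned by the columns of `G`, ordered by `r`. -/
noncomputable def flagStabilizer (G : GL ι ℂ) {n : ℕ} (r : ι ≃ Fin n) :
    LieSubalgebra ℂ (sl ι ℂ) where
  carrier := {y | ∀ p q, r p < r q → conjMatrix G y p q = 0}
  add_mem' := fun {x y} hx hy p q h => by
    rw [map_add, Matrix.add_apply, hx p q h, hy p q h, add_zero]
  zero_mem' := fun p q _ => by rw [map_zero]; rfl
  smul_mem' := fun c x hx p q h => by rw [map_smul, Matrix.smul_apply, hx p q h, smul_zero]
  lie_mem' := fun {x y} hx hy p q h => by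
    have aux : ∀ {x y : sl ι ℂ}, (∀ p q, r p < r q → conjMatrix G x p q = 0) →
        (∀ p q, r p < r q → conjMatrix G y p q = 0) →
        (conjMatrix G x * conjMatrix G y) p q = 0 := by
      intro x y hx hy
      rw [Matrix.mul_apply]
      refine Finset.sum_eq_zero fun s _ => ?_
      rcases lt_or_ge (r p) (r s) with h1 | h1
      · rw [hx p s h1, zero_mul]
      · rw [hy s q (h1.trans_lt h), mul_zero]
    rw [conjMatrix_lie, Matrix.sub_apply, aux hx hy, aux hy hx, sub_zero]

variable {n : ℕ}

/-- The chain is by distance from the diagonal. For `k = 0` the bracket kills diagonal entries, as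
these multiply in products of triangular matrices; for `k > 0` the distances add. -/
theorem isSolvable_flagStabilizer (G : GL ι ℂ) (r : ι ≃ Fin n) :
    LieAlgebra.IsSolvable (flagStabilizer G r) := by
  let N : ℕ → Submodule ℂ (flagStabilizer G r) := fun k =>
    { carrier := {y | ∀ p q, (r p : ℕ) < r q + k → conjMatrix G y.1 p q = 0}
      add_mem' := fun {x y} hx hy p q h => by
        change conjMatrix G (x.1 + y.1) p q = 0
        rw [map_add, Matrix.add_apply, hx p q h, hy p q h, add_zero]
      zero_mem' := fun p q _ => by
        change conjMatrix G 0 p q = 0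
        rw [map_zero]
        rfl
      smul_mem' := fun c x hx p q h => by
        change conjMatrix G (c • x.1) p q = 0
        rw [map_smul, Matrix.smul_apply, hx p q h, smul_zero] }
  refine LieAlgebra.isSolvable_of_chain N ?_ (m := n) ?_ ?_
  · rw [eq_top_iff]
    intro y _ p q h
    exact y.2 p q h
  · rw [eq_bot_iff]
    intro y hy
    refine Subtype.ext (conjMatrix_injective G ?_)
    change conjMatrix G y.1 = conjMatrix G 0
    rw [map_zero]
    ext p q
    exact hy p q (by omega)
  · intro k x hx y hy p q h
    change conjMatrix G ⁅x.1, y.1⁆ p q = 0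
    rw [conjMatrix_lie, Matrix.sub_apply, Matrix.mul_apply, Matrix.mul_apply]
    by_cases hpq : p = q
    · subst hpq
      have aux : ∀ {x y : flagStabilizer G r}, ∑ s, conjMatrix G x.1 p s * conjMatrix G y.1 s p =
          conjMatrix G x.1 p p * conjMatrix G y.1 p p := by
        intro x y
        refine Finset.sum_eq_single p (fun s _ hs => ?_) (by simp)
        rcases lt_or_gt_of_ne (r.injective.ne hs) with h1 | h1
        · rw [y.2 s p h1, mul_zero]
        · rw [x.2 p s h1, zero_mul]
      rw [aux, aux]
      ring
    · have hrpq : (r p : ℕ) ≠ r q := fun e => hpq (r.injective (Fin.ext e))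
      have aux : ∀ {x y : flagStabilizer G r}, x ∈ N k → y ∈ N k →
          ∑ s, conjMatrix G x.1 p s * conjMatrix G y.1 s q = 0 := by
        intro x y hx hy
        refine Finset.sum_eq_zero fun s _ => ?_
        by_cases h1 : (r p : ℕ) < r s + k
        · rw [hx p s h1, zero_mul]
        · by_cases h2 : (r s : ℕ) < r q + k
          · rw [hy s q h2, mul_zero]
          · exfalso
            omega
      rw [aux hx hy, aux hy hx, sub_zero]

/-- The off-diagonal matrix units in a stabilizer record the order, so inclusion makes the change of
order increasing. -/
theorem eq_of_flagStabilizer_le {G : GL ι ℂ} {r r' : ι ≃ Fin n}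
    (h : flagStabilizer G r ≤ flagStabilizer G r') : r = r' := by
  have hmono : ∀ p q, r q < r p → r' q < r' p := by
    intro p q hlt
    have hpq : p ≠ q := fun e => hlt.ne (congrArg r e.symm)
    by_contra hc
    have hlt' : r' p < r' q := lt_of_le_of_ne (not_lt.1 hc) (r'.injective.ne hpq)
    obtain ⟨y, hy⟩ := exists_conjMatrix_eq_single G hpq
    have hmem : y ∈ flagStabilizer G r := by
      intro p' q' h'
      rw [hy, Matrix.single_apply_of_ne]
      rintro ⟨rfl, rfl⟩
      exact absurd h' hlt.not_gt
    have := h hmem p q hlt'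
    rw [hy, Matrix.single_apply_same] at this
    exact one_ne_zero this
  have hone : (r.symm.trans r' : Equiv.Perm (Fin n)) = 1 := by
    refine Equiv.Perm.eq_one_of_forall_lt _ fun i j hij => ?_
    refine hmono _ _ ?_
    rw [Equiv.apply_symm_apply, Equiv.apply_symm_apply, Fin.lt_def]
    omega
  ext1 p
  have := congrArg (fun w : Equiv.Perm (Fin n) => w (r p)) hone
  simpa using this.symm

/-- The algebra contains `h₁ + Complex.I • h₂`, whose distinct diagonal entries are what
`exists_triangular_order` requires. -/
theorem exists_le_flagStabilizer (hn : Fintype.card ι = n) {G : GL ι ℂ}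
    {b : LieSubalgebra ℂ (sl ι ℂ)} (hb : LieAlgebra.IsSolvable b) {h₁ h₂ : sl ι ℂ} (hb₁ : h₁ ∈ b)
    (hb₂ : h₂ ∈ b) {η₁ η₂ : ι → ℂ} (hη₁ : conjMatrix G h₁ = Matrix.diagonal η₁)
    (hη₂ : conjMatrix G h₂ = Matrix.diagonal η₂)
    (hη : Function.Injective fun c => η₁ c + Complex.I * η₂ c) :
    ∃ r : ι ≃ Fin n, b ≤ flagStabilizer G r := by
  have hmem : h₁ + Complex.I • h₂ ∈ b := b.add_mem hb₁ (b.smul_mem _ hb₂)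
  let ρ : b →ₗ[ℂ] Matrix ι ι ℂ :=
    { toFun := fun y => conjMatrix G y.1
      map_add' := fun x y => map_add (conjMatrix G) x.1 y.1
      map_smul' := fun c x => map_smul (conjMatrix G) c x.1 }
  have hdiag : ρ ⟨_, hmem⟩ = Matrix.diagonal fun c => η₁ c + Complex.I * η₂ c := by
    change conjMatrix G (h₁ + Complex.I • h₂) = _
    rw [map_add, map_smul, hη₁, hη₂, ← Matrix.diagonal_smul, Matrix.diagonal_add]
    rfl
  obtain ⟨r, hr⟩ := exists_triangular_order ρ (fun x y => conjMatrix_lie G x.1 y.1) hη hdiag hn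
  exact ⟨r, fun y hy p q h => hr ⟨y, hy⟩ p q h⟩

/-- The Borel subalgebras that contain a pair `e` and a pair `h` that is diagonal in the basis of
the columns of `G`, with distinct joint eigenvalues, correspond to the orders of the basis for
which `e` is triangular. -/
theorem nonempty_equiv_borelVariety (hn : Fintype.card ι = n) {G : GL ι ℂ}
    {e h : sl ι ℂ × sl ι ℂ} {η₁ η₂ : ι → ℂ} (hη₁ : conjMatrix G h.1 = Matrix.diagonal η₁)
    (hη₂ : conjMatrix G h.2 = Matrix.diagonal η₂)
    (hη : Function.Injective fun c => η₁ c + Complex.I * η₂ c) :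
    Nonempty ({r : ι ≃ Fin n // ∀ p q, r p < r q →
      conjMatrix G e.1 p q = 0 ∧ conjMatrix G e.2 p q = 0} ≃ borelVariety e h) := by
  have hdiag : ∀ (r : ι ≃ Fin n) {y : sl ι ℂ} {η : ι → ℂ},
      conjMatrix G y = Matrix.diagonal η → y ∈ flagStabilizer G r := by
    intro r y η hy p q hlt
    rw [hy, Matrix.diagonal_apply_ne]
    rintro rfl
    exact lt_irrefl _ hlt
  -- A larger solvable subalgebra still contains the diagonal pair, so it lies in another such
  -- stabilizer, and the inclusion forces the same order.
  have hborel : ∀ r : ι ≃ Fin n, IsBorelSubalgebra (flagStabilizer G r) := by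
    intro r
    refine ⟨isSolvable_flagStabilizer G r, fun b hb hle => ?_⟩
    obtain ⟨r', hr'⟩ := exists_le_flagStabilizer hn hb (hle (hdiag r hη₁)) (hle (hdiag r hη₂))
      hη₁ hη₂ hη
    rwa [eq_of_flagStabilizer_le (hle.trans hr')]
  refine ⟨Equiv.ofBijective (fun r => ⟨flagStabilizer G r.1, hborel r.1,
    fun p q hlt => (r.2 p q hlt).1, fun p q hlt => (r.2 p q hlt).2, hdiag r.1 hη₁,
    hdiag r.1 hη₂⟩) ⟨?_, ?_⟩⟩
  · rintro r r' hrr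
    exact Subtype.ext (eq_of_flagStabilizer_le (congrArg Subtype.val hrr).le)
  · rintro ⟨b, hb, he₁, he₂, hh₁, hh₂⟩
    obtain ⟨r, hr⟩ := exists_le_flagStabilizer hn hb.1 hh₁ hh₂ hη₁ hη₂ hη
    exact ⟨⟨r, fun p q hlt => ⟨hr he₁ p q hlt, hr he₂ p q hlt⟩⟩,
      Subtype.ext ((hb.2 (isSolvable_flagStabilizer G r) hr).antisymm hr)⟩

end Flags

/-! ### From Borel subalgebras to standard tableaux -/

namespace SkewDiagram

variable {σ : SkewDiagram}

/-- An entry at `p q` of one of the two matrices is nonzero exactly when an arrow leads from the box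
of `q` to that of `p`. Triangularity thus means that numbers grow along arrows. -/
theorem isStandard_iff_moveMatrix {φ : σ.cells ≃ Fin σ.size} {r : Fin σ.size ≃ Fin σ.size} :
    (∀ p q, r p < r q → σ.moveMatrix φ East p q = 0 ∧ σ.moveMatrix φ South p q = 0) ↔
      IsStandard (φ.trans r).symm := by
  classical
  have hbox : ∀ c, box φ (φ c) = c.1 := fun c => by simp [box]
  constructor
  · intro h c d hcd
    change r (φ c) < r (φ d)
    have hne : r (φ c) ≠ r (φ d) := fun e => by
      have e' := φ.injective (r.injective e)
      rw [e'] at hcd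
      have := hcd.diag_eq
      omega
    by_contra hc
    have := h (φ d) (φ c) (lt_of_le_of_ne (not_lt.1 hc) hne.symm)
    rw [moveMatrix_apply, moveMatrix_apply, hbox, hbox] at this
    rcases hcd with hcd | hcd
    · simp [hcd] at this
    · simp [hcd] at this
  · intro h p q hlt
    have key : ¬Arrow (box φ q) (box φ p) := fun hc => by
      have h1 := h (φ.symm q) (φ.symm p) hc
      have h2 : r (φ (φ.symm q)) < r (φ (φ.symm p)) := h1
      rw [Equiv.apply_symm_apply, Equiv.apply_symm_apply] at h2
      exact absurd hlt h2.not_gt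
    rw [moveMatrix_apply, moveMatrix_apply, if_neg fun hc => key (Or.inl hc),
      if_neg fun hc => key (Or.inr hc)]
    exact ⟨rfl, rfl⟩

/-- The Borel subalgebras that contain a distinguished nilpotent pair and an associated semisimple
pair correspond to the standard tableaux. -/
theorem nonempty_borelVariety_equiv (hσ : σ.Connected) {e h : σ.sl × σ.sl} (he : σ.IsAttached e)
    (hh : IsAssociatedSemisimplePair e h) :
    Nonempty (borelVariety e h ≃ {T : Fin σ.size ≃ σ.cells // IsStandard T}) := by
  obtain ⟨φ, G, η₁, η₂, he₁, he₂, hη₁, hη₂, hη⟩ := exists_normal_form hσ he hh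
  obtain ⟨E⟩ := nonempty_equiv_borelVariety (Fintype.card_fin σ.size) (G := G) (e := e) hη₁ hη₂ hη
  refine ⟨E.symm.trans (Equiv.subtypeEquiv ((Equiv.equivCongr φ.symm (Equiv.refl _)).trans
    (Equiv.symmEquiv _ _)) fun r => ?_)⟩
  rw [conjMatrix_apply, conjMatrix_apply, he₁, he₂, isStandard_iff_moveMatrix]
  rfl

/-- The size of the multisegment and the number of boxes agree only propositionally, so tableaux
must be transported. -/
theorem nonempty_standard_equiv {M N : ℕ} (h : M = N) :
    Nonempty ({T : Fin M ≃ σ.cells // IsStandard T} ≃ {T : Fin N ≃ σ.cells // IsStandard T}) := by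
  subst h
  exact ⟨Equiv.refl _⟩

end SkewDiagram

theorem corollary5p6 (σ : SkewDiagram) (hσ : σ.Connected) (a : ℤ) (e h : σ.sl × σ.sl)
    (he : σ.IsAttached e) (hh : IsAssociatedSemisimplePair e h) :
    IsSimpleModule (GradedHecke (σ.multisegment a).size) (σ.Ladder a) ∧
      (borelVariety e h).Finite ∧
      Nonempty (GradedHecke.weights (n := (σ.multisegment a).size) (σ.Ladder a) ≃
        borelVariety e h) := by
  obtain ⟨E⟩ := SkewDiagram.nonempty_borelVariety_equiv hσ he hh
  obtain ⟨F⟩ := SkewDiagram.nonempty_weights_ladder_equiv hσ a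
  obtain ⟨I⟩ := SkewDiagram.nonempty_standard_equiv (σ := σ)
    (SkewDiagram.multisegment_size (σ := σ) a)
  have : Finite (borelVariety e h) := Finite.of_equiv _ E.symm
  exact ⟨SkewDiagram.isSimpleModule_ladder hσ a, Set.toFinite _, ⟨(F.trans I).trans E.symm⟩⟩
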